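/- Let $n\ge 0$, let $M=\{1,\dots,n\}$ and let $M'=\{1',\dots,n'\}$ be a disjoint copy of $M$. Let $\mathfrak{C}_n$ be the monoid of all set partitions of $M\cup M'$, where the product $\alpha\beta$ is obtained by identifying, for each $k\in M$, the element $k'$ of $\alpha$ with the element $k$ of $\beta$: two elements of (left copy $M$ of $\alpha$) $\cup$ (right copy $M'$ of $\beta$) lie in the same block of $\alpha\beta$ if and only if they can be joined by a finite sequence in which any two consecutive elements lie in a common block of $\alpha$ or in a common block of $\beta$. The Brauer monoid $\mathfrak{B}_n$ is the submonoid of $\mathfrak{C}_n$ that consists of all partitions all of whose blocks have exactly two elements. For $1\le i\le n-1$ let $s_i\in\mathfrak{B}_n$ be the partition with the blocks $\{i,(i+1)'\}$, $\{i+1,i'\}$ and $\{j,j'\}$ for $j\ne i,i+1$ (that is, the transposition $(i,i+1)$), and let $\pi_i\in\mathfrak{B}_n$ be the partition with the blocks $\{i,i+1\}$, $\{i',(i+1)'\}$ and $\{j,j'\}$ for $j\neq i,i+1$. Let $T$ be the monoid with identity $e$ generated by $\sigma_i,\theta_i$ ($1\le i\le n-1$) subject to the following relations, for all $i,j\in\{1,\dots,n-1\}$: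 \begin{gather*} \sigma_i^2=e;\quad \sigma_i\sigma_j=\sigma_j\sigma_i \ (|i-j|>1);\quad \sigma_i\sigma_j\sigma_i=\sigma_j\sigma_i\sigma_j\ (|i-j|=1);\\ \theta_i^2=\theta_i;\quad \theta_i\theta_j=\theta_j\theta_i\ (|i-j|>1);\quad \theta_i\theta_j\theta_i=\theta_i\ (|i-j|=1);\\ \theta_i\sigma_i=\sigma_i\theta_i=\theta_i;\quad \theta_i\sigma_j=\sigma_j\theta_i\ (|i-j|>1);\\ \sigma_i\theta_j\theta_i=\sigma_j\theta_i,\quad \theta_i\theta_j\sigma_i=\theta_i\sigma_j\ (|i-j|=1). \end{gather*} Theorem. The map $\sigma_i\mapsto s_i$, $\theta_i\mapsto\pi_i$, $i=1,\dots,n-1$, extends to an isomorphism of monoids $\varphi:T\to\mathfrak{B}_n$. -/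

import Mathlib

/-- The pins of a chip with `n` pins on either side: `Sum.inl k` is the left pin `k ∈ M` and
`Sum.inr k` is the right pin `k' ∈ M'`. -/
abbrev Pin (n : ℕ) : Type := Fin n ⊕ Fin n

/-- The set `ℭ_n` of all decompositions of `M ∪ M'` into disjoint unions of subsets, a
decomposition being given by the relation "lies in the same block as". -/
def PartitionMonoid (n : ℕ) : Type := Setoid (Pin n)

namespace PartitionMonoid

variable {n : ℕ}

/-- `α.Same x y`: the pins `x` and `y` belong to the same block of `α`. -/
def Same (α : PartitionMonoid n) (x y : Pin n) : Prop := Setoid.r (self := α) x y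

theorem Same.refl (α : PartitionMonoid n) (x : Pin n) : α.Same x x := Setoid.refl' α x

theorem Same.symm {α : PartitionMonoid n} {x y : Pin n} (h : α.Same x y) : α.Same y x :=
  Setoid.symm' α h

theorem Same.trans {α : PartitionMonoid n} {x y z : Pin n} (h : α.Same x y) (h' : α.Same y z) :
    α.Same x z := Setoid.trans' α h h'

@[ext]
theorem ext {α β : PartitionMonoid n} (h : ∀ x y, α.Same x y ↔ β.Same x y) : α = β :=
  Setoid.ext h

/-- The blocks of a decomposition. -/
def blocks (α : PartitionMonoid n) : Set (Set (Pin n)) := Setoid.classes α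

/-- The decomposition whose blocks are the nonempty fibres of `f`. -/
def ofFibres {ι : Type} (f : Pin n → ι) : PartitionMonoid n := Setoid.ker f

@[simp]
theorem ofFibres_same {ι : Type} (f : Pin n → ι) (x y : Pin n) :
    (ofFibres f).Same x y ↔ f x = f y := Iff.rfl

/-- The pins of two chips put next to each other, the right pins of the first chip being
identified with the left pins of the second one: left pins of the first chip, identified pins,
right pins of the second chip. -/
abbrev Pin₃ (n : ℕ) : Type := Fin n ⊕ Fin n ⊕ Fin n

/-- The pins of the first chip among the pins of the two chips. -/
def fst : Pin n → Pin₃ n := Sum.map id Sum.inl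

/-- The pins of the second chip among the pins of the two chips. -/
def snd : Pin n → Pin₃ n := Sum.inr

/-- The remaining (not identified) pins among the pins of the two chips. -/
def outer : Pin n → Pin₃ n := Sum.map id Sum.inr

/-- Two pins are linked if they belong to the same block of the first or of the second chip. -/
inductive Link (α β : PartitionMonoid n) : Pin₃ n → Pin₃ n → Prop
  | left {x y : Pin n} (h : α.Same x y) : Link α β (fst x) (fst y)
  | right {x y : Pin n} (h : β.Same x y) : Link α β (snd x) (snd y)

/-- Two pins are connected if some finite sequence of links joins them. -/
def Conn (α β : PartitionMonoid n) : Pin₃ n → Pin₃ n → Prop := Relation.EqvGen (Link α β)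

/-- The product of `α` and `β`: two remaining pins belong to the same block if and only if they
are connected through `α` and `β`. -/
instance : Mul (PartitionMonoid n) where
  mul α β :=
    { r := fun x y => Conn α β (outer x) (outer y)
      iseqv :=
        { refl := fun _ => .refl _
          symm := fun h => .symm _ _ h
          trans := fun h h' => .trans _ _ _ h h' } }

/-- The identity decomposition, with blocks `{k, k'}`. -/
instance : One (PartitionMonoid n) where
  one := ofFibres (Sum.elim id id)

theorem mul_same (α β : PartitionMonoid n) (x y : Pin n) :
    (α * β).Same x y ↔ Conn α β (outer x) (outer y) := Iff.rfl

theorem one_same (x y : Pin n) :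
    (1 : PartitionMonoid n).Same x y ↔ Sum.elim id id x = Sum.elim id id y := Iff.rfl

theorem Conn.lift {α β : PartitionMonoid n} {V : Type} (E : V → V → Prop) (hE : Equivalence E)
    (f : Pin₃ n → V) (h₁ : ∀ x y, α.Same x y → E (f (fst x)) (f (fst y)))
    (h₂ : ∀ x y, β.Same x y → E (f (snd x)) (f (snd y))) {v w : Pin₃ n} (h : Conn α β v w) :
    E (f v) (f w) := by
  induction h with
  | rel v w h =>
    cases h with
    | left h => exact h₁ _ _ h
    | right h => exact h₂ _ _ h
  | refl v => exact hE.refl _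
  | symm v w _ ih => exact hE.symm ih
  | trans u v w _ _ ih ih' => exact hE.trans ih ih'

theorem same_equivalence (α : PartitionMonoid n) : Equivalence α.Same :=
  ⟨Same.refl α, Same.symm, Same.trans⟩

protected theorem one_mul (α : PartitionMonoid n) : 1 * α = α := by
  ext x y
  rw [mul_same]
  constructor
  · intro h
    have := Conn.lift α.Same α.same_equivalence (Sum.elim Sum.inl id)
      (fun x y h => by
        rw [one_same] at h
        rcases x with x | x <;> rcases y with y | y <;> simp at h <;> subst h <;>
          exact Same.refl _ _)
      (fun x y h => by simpa [snd] using h) h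
    rcases x with x | x <;> rcases y with y | y <;> simpa [outer] using this
  · intro h
    have key : ∀ z : Pin n, Conn 1 α (outer z) (snd z) := by
      rintro (z | z)
      · exact .rel _ _ (Link.left (x := Sum.inl z) (y := Sum.inr z) (by simp [one_same]))
      · exact .refl _
    exact .trans _ _ _ (key x) (.trans _ _ _ (.rel _ _ (.right h)) (.symm _ _ (key y)))

protected theorem mul_one (α : PartitionMonoid n) : α * 1 = α := by
  ext x y
  rw [mul_same]
  constructor
  · intro h
    have := Conn.lift α.Same α.same_equivalence (Sum.elim Sum.inl (Sum.elim Sum.inr Sum.inr))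
      (fun x y h => by
        rcases x with x | x <;> rcases y with y | y <;> simpa [fst] using h)
      (fun x y h => by
        rw [one_same] at h
        rcases x with x | x <;> rcases y with y | y <;> simp at h <;> subst h <;>
          exact Same.refl _ _) h
    rcases x with x | x <;> rcases y with y | y <;> simpa [outer] using this
  · intro h
    have key : ∀ z : Pin n, Conn α 1 (outer z) (fst z) := by
      rintro (z | z)
      · exact .refl _
      · exact .rel _ _ (Link.right (x := Sum.inr z) (y := Sum.inl z) (by simp [one_same]))
    exact .trans _ _ _ (key x) (.trans _ _ _ (.rel _ _ (.left h)) (.symm _ _ (key y)))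

/-- The pins of three chips put next to each other. -/
abbrev Pin₄ (n : ℕ) : Type := Fin n ⊕ Fin n ⊕ Fin n ⊕ Fin n

/-- Links between the pins of three chips. -/
inductive Link₃ (α β γ : PartitionMonoid n) : Pin₄ n → Pin₄ n → Prop
  | left {x y : Pin n} (h : α.Same x y) :
      Link₃ α β γ (Sum.map id Sum.inl x) (Sum.map id Sum.inl y)
  | mid {x y : Pin n} (h : β.Same x y) :
      Link₃ α β γ (Sum.inr (Sum.map id Sum.inl x)) (Sum.inr (Sum.map id Sum.inl y))
  | right {x y : Pin n} (h : γ.Same x y) : Link₃ α β γ (Sum.inr (Sum.inr x)) (Sum.inr (Sum.inr y))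

theorem eqvGen_lift {V W : Type} {r : V → V → Prop} (E : W → W → Prop) (hE : Equivalence E)
    (f : V → W) (h : ∀ v w, r v w → E (f v) (f w)) {v w : V} (hvw : Relation.EqvGen r v w) :
    E (f v) (f w) := by
  induction hvw with
  | rel v w h' => exact h _ _ h'
  | refl v => exact hE.refl _
  | symm v w _ ih => exact hE.symm ih
  | trans u v w _ _ ih ih' => exact hE.trans ih ih'

theorem conn_equivalence (α β : PartitionMonoid n) : Equivalence (Conn α β) :=
  Relation.EqvGen.is_equivalence _

theorem mul_mul_same_left (α β γ : PartitionMonoid n) (x y : Pin n) :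
    (α * β * γ).Same x y ↔
      Relation.EqvGen (Link₃ α β γ) (Sum.map id (Sum.inr ∘ Sum.inr) x)
        (Sum.map id (Sum.inr ∘ Sum.inr) y) := by
  have hE := Relation.EqvGen.is_equivalence (Link₃ α β γ)
  rw [mul_same]
  constructor
  · intro h
    have := Conn.lift _ hE (Sum.map id Sum.inr) (fun x y h => by
        have := Conn.lift _ hE (Sum.map id (Sum.map id Sum.inl))
          (fun x y h => by
            have := Relation.EqvGen.rel _ _ (Link₃.left (β := β) (γ := γ) h)
            rcases x with x | x <;> rcases y with y | y <;> exact this)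
          (fun x y h => Relation.EqvGen.rel _ _ (Link₃.mid (α := α) (γ := γ) h)) h
        rcases x with x | x <;> rcases y with y | y <;> exact this)
      (fun x y h => Relation.EqvGen.rel _ _ (Link₃.right (α := α) (β := β) h)) h
    rcases x with x | x <;> rcases y with y | y <;> exact this
  · intro h
    let C : Pin₃ n → Pin₄ n → Prop := fun u v => match v with
      | Sum.inl l => Conn (α * β) γ u (Sum.inl l)
      | Sum.inr (Sum.inl a) =>
          ∃ p : Pin n, Conn α β (outer p) (Sum.inr (Sum.inl a)) ∧ Conn (α * β) γ u (fst p)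
      | Sum.inr (Sum.inr p) => Conn (α * β) γ u (snd p)
    have hC : ∀ (u : Pin₃ n) (v : Pin₃ n), C u (Sum.map id (Sum.map id Sum.inl) v) ↔
        ∃ p : Pin n, Conn α β (outer p) v ∧ Conn (α * β) γ u (fst p) := by
      have aux : ∀ (u : Pin₃ n) (q : Pin n), Conn (α * β) γ u (fst q) ↔
          ∃ p : Pin n, Conn α β (outer p) (outer q) ∧ Conn (α * β) γ u (fst p) := fun u q =>
        ⟨fun h => ⟨q, .refl _, h⟩, fun ⟨p, h, h'⟩ => .trans _ _ _ h' (.rel _ _ (.left h))⟩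
      rintro u (v | v | v)
      · exact aux u (Sum.inl v)
      · exact Iff.rfl
      · exact aux u (Sum.inr v)
    have hC' : ∀ {v w : Pin₃ n}, Conn α β v w → ∀ u,
        C u (Sum.map id (Sum.map id Sum.inl) v) ↔ C u (Sum.map id (Sum.map id Sum.inl) w) := by
      intro v w h u
      rw [hC, hC]
      exact ⟨fun ⟨p, h₁, h₂⟩ => ⟨p, .trans _ _ _ h₁ h, h₂⟩,
        fun ⟨p, h₁, h₂⟩ => ⟨p, .trans _ _ _ h₁ (.symm _ _ h), h₂⟩⟩
    have := eqvGen_lift (fun v w => ∀ u, C u v ↔ C u w)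
      ⟨fun _ _ => Iff.rfl, fun h u => (h u).symm, fun h h' u => (h u).trans (h' u)⟩ id
      (fun v w h => by
        cases h with
        | @left x y h =>
          have := hC' (.rel _ _ (Link.left (β := β) h))
          rcases x with x | x <;> rcases y with y | y <;> exact this
        | @mid x y h => exact hC' (.rel _ _ (Link.right (α := α) h))
        | @right x y h =>
          intro u
          have h' : Conn (α * β) γ (snd x) (snd y) := .rel _ _ (.right h)
          exact ⟨fun h₁ => .trans _ _ _ h₁ h', fun h₁ => .trans _ _ _ h₁ (.symm _ _ h')⟩) h
    have := (this (outer x)).1 (by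
      rcases x with x | x <;> exact Relation.EqvGen.refl _)
    rcases y with y | y <;> exact this

theorem mul_mul_same_right (α β γ : PartitionMonoid n) (x y : Pin n) :
    (α * (β * γ)).Same x y ↔
      Relation.EqvGen (Link₃ α β γ) (Sum.map id (Sum.inr ∘ Sum.inr) x)
        (Sum.map id (Sum.inr ∘ Sum.inr) y) := by
  have hE := Relation.EqvGen.is_equivalence (Link₃ α β γ)
  rw [mul_same]
  constructor
  · intro h
    have := Conn.lift _ hE (Sum.map id (Sum.map id Sum.inr))
      (fun x y h => by
        have := Relation.EqvGen.rel _ _ (Link₃.left (β := β) (γ := γ) h)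
        rcases x with x | x <;> rcases y with y | y <;> exact this)
      (fun x y h => by
        have := Conn.lift _ hE Sum.inr
          (fun x y h => Relation.EqvGen.rel _ _ (Link₃.mid (α := α) (γ := γ) h))
          (fun x y h => Relation.EqvGen.rel _ _ (Link₃.right (α := α) (β := β) h)) h
        rcases x with x | x <;> rcases y with y | y <;> exact this) h
    rcases x with x | x <;> rcases y with y | y <;> exact this
  · intro h
    let C : Pin₃ n → Pin₄ n → Prop := fun u v => match v with
      | Sum.inl l => Conn α (β * γ) u (Sum.inl l)
      | Sum.inr v => ∃ p : Pin n, Conn β γ (outer p) v ∧ Conn α (β * γ) u (snd p)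
    have aux : ∀ (u : Pin₃ n) (q : Pin n), C u (Sum.inr (outer q)) ↔
        Conn α (β * γ) u (snd q) := fun u q =>
      ⟨fun ⟨p, h, h'⟩ => .trans _ _ _ h' (.rel _ _ (.right h)), fun h => ⟨q, .refl _, h⟩⟩
    have hC : ∀ (u : Pin₃ n) (v : Pin n), C u (Sum.map id Sum.inl v) ↔
        Conn α (β * γ) u (fst v) := by
      rintro u (v | v)
      · exact Iff.rfl
      · exact aux u (Sum.inl v)
    have hC' : ∀ {v w : Pin₃ n}, Conn β γ v w → ∀ u, C u (Sum.inr v) ↔ C u (Sum.inr w) := by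
      intro v w h u
      exact ⟨fun ⟨p, h₁, h₂⟩ => ⟨p, .trans _ _ _ h₁ h, h₂⟩,
        fun ⟨p, h₁, h₂⟩ => ⟨p, .trans _ _ _ h₁ (.symm _ _ h), h₂⟩⟩
    have := eqvGen_lift (fun v w => ∀ u, C u v ↔ C u w)
      ⟨fun _ _ => Iff.rfl, fun h u => (h u).symm, fun h h' u => (h u).trans (h' u)⟩ id
      (fun v w h => by
        cases h with
        | @left x y h =>
          intro u
          have h' : Conn α (β * γ) (fst x) (fst y) := .rel _ _ (.left h)
          exact (hC u x).trans (Iff.trans ⟨fun h₁ => .trans _ _ _ h₁ h',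
            fun h₁ => .trans _ _ _ h₁ (.symm _ _ h')⟩ (hC u y).symm)
        | @mid x y h => exact hC' (.rel _ _ (Link.left (β := γ) h))
        | @right x y h => exact hC' (.rel _ _ (Link.right (α := β) h))) h
    have := (this (outer x)).1 (by
      rcases x with x | x
      · exact Relation.EqvGen.refl _
      · exact (aux _ (Sum.inr x)).2 (.refl _))
    rcases y with y | y
    · exact this
    · exact (aux _ (Sum.inr y)).1 this

instance : Monoid (PartitionMonoid n) where
  mul_assoc α β γ := by
    ext x y
    rw [mul_mul_same_left, mul_mul_same_right]
  one_mul := PartitionMonoid.one_mul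
  mul_one := PartitionMonoid.mul_one

/-- A line: a two-element set of pins that meets both `M` and `M'`. -/
def IsLine (X : Set (Pin n)) : Prop :=
  X.ncard = 2 ∧ (∃ k, Sum.inl k ∈ X) ∧ ∃ k, Sum.inr k ∈ X

/-- A bracket: a two-element set of pins that is contained in `M` or in `M'`. -/
def IsBracket (X : Set (Pin n)) : Prop :=
  X.ncard = 2 ∧ (X ⊆ Set.range Sum.inl ∨ X ⊆ Set.range Sum.inr)

/-- Each block of `α` is either a line or a bracket. -/
def IsBrauer (α : PartitionMonoid n) : Prop := ∀ X ∈ α.blocks, IsLine X ∨ IsBracket X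

theorem isLine_or_isBracket_iff (X : Set (Pin n)) : IsLine X ∨ IsBracket X ↔ X.ncard = 2 := by
  constructor
  · rintro (h | h) <;> exact h.1
  · intro h
    by_cases h₁ : ∃ k, Sum.inl k ∈ X
    · by_cases h₂ : ∃ k, Sum.inr k ∈ X
      · exact Or.inl ⟨h, h₁, h₂⟩
      · refine Or.inr ⟨h, Or.inl ?_⟩
        rintro (k | k) hk
        · exact ⟨k, rfl⟩
        · exact (h₂ ⟨k, hk⟩).elim
    · refine Or.inr ⟨h, Or.inr ?_⟩
      rintro (k | k) hk
      · exact (h₁ ⟨k, hk⟩).elim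
      · exact ⟨k, rfl⟩

theorem isBrauer_iff (α : PartitionMonoid n) :
    α.IsBrauer ↔ ∀ x, ∃! y, y ≠ x ∧ α.Same x y := by
  have h₀ : α.IsBrauer ↔ ∀ x, {y | α.Same y x}.ncard = 2 := by
    unfold IsBrauer
    simp only [isLine_or_isBracket_iff]
    exact ⟨fun h x => h _ ⟨x, rfl⟩, by rintro h _ ⟨x, rfl⟩; exact h x⟩
  rw [h₀]
  refine forall_congr' fun x => ?_
  constructor
  · intro h
    obtain ⟨a, b, hab, hX⟩ := Set.ncard_eq_two.1 h
    have hm : ∀ y, α.Same x y ↔ y = a ∨ y = b := fun y => by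
      have : y ∈ {y | α.Same y x} ↔ y ∈ ({a, b} : Set (Pin n)) := by rw [hX]
      exact ⟨fun h => this.1 h.symm, fun h => (this.2 h).symm⟩
    rcases (hm x).1 (Same.refl _ _) with rfl | rfl
    · exact ⟨b, ⟨hab.symm, (hm _).2 (Or.inr rfl)⟩, fun y hy => ((hm y).1 hy.2).resolve_left hy.1⟩
    · exact ⟨a, ⟨hab, (hm _).2 (Or.inl rfl)⟩, fun y hy => ((hm y).1 hy.2).resolve_right hy.1⟩
  · rintro ⟨y, ⟨hy, hxy⟩, hu⟩
    refine Set.ncard_eq_two.2 ⟨x, y, hy.symm, ?_⟩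
    ext z
    constructor
    · intro hz
      by_cases hzx : z = x
      · exact Or.inl hzx
      · exact Or.inr (hu z ⟨hzx, Same.symm hz⟩)
    · rintro (rfl | rfl)
      · exact Same.refl _ _
      · exact hxy.symm

/-- On an orbit of the group generated by two involutions of a finite set, points fixed by one
of the involutions come in pairs. -/
theorem existsUnique_fixed {V : Type} [Finite V] {a b : V → V} (ha : Function.Involutive a)
    (hb : Function.Involutive b) {r : V → V → Prop}
    (hr : ∀ v w, r v w → w = v ∨ w = a v ∨ w = b v) (hra : ∀ v, Relation.EqvGen r v (a v))
    (hrb : ∀ v, Relation.EqvGen r v (b v)) {x : V} (hx : b x = x) (hx' : a x ≠ x) :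
    ∃! y, y ≠ x ∧ (a y = y ∨ b y = y) ∧ Relation.EqvGen r x y := by
  set c : V → V := b ∘ a with hc
  have hinj : Function.Injective c := hb.injective.comp ha.injective
  have hbk : ∀ k : ℕ, c^[k] (b (c^[k] x)) = x := by
    intro k
    induction k with
    | zero => simpa using hx
    | succ k ih =>
      rw [Function.iterate_succ_apply' c k x, Function.iterate_succ_apply c k]
      have : c (b (c (c^[k] x))) = b (c^[k] x) := by simp [hc, hb _, ha _]
      rw [this, ih]
  have hak : ∀ k : ℕ, c^[k + 1] (a (c^[k] x)) = x := by
    intro k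
    induction k with
    | zero => simp [hc, ha _, hx]
    | succ k ih =>
      rw [Function.iterate_succ_apply' c k x, Function.iterate_succ_apply c (k + 1)]
      have : c (a (c (c^[k] x))) = a (c^[k] x) := by simp [hc, hb _, ha _]
      rw [this, ih]
  set N := Function.minimalPeriod c x with hN
  have hper : ∀ m, c^[m] x = x ↔ N ∣ m := fun m => Function.isPeriodicPt_iff_minimalPeriod_dvd
  have hNpos : 0 < N :=
    Function.minimalPeriod_pos_of_mem_periodicPts (hinj.mem_periodicPts x)
  have hN1 : N ≠ 1 := by
    intro h
    have : c^[1] x = x := (hper 1).2 (by rw [h])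
    apply hx'
    have h2 : b (a x) = x := this
    have h3 := congrArg b h2
    rw [hb, hx] at h3
    exact h3
  have hbfix : ∀ k, b (c^[k] x) = c^[k] x ↔ N ∣ k + k := by
    intro k
    rw [← hper, Function.iterate_add_apply]
    constructor
    · intro h
      have := hbk k
      rwa [h] at this
    · intro h
      exact hinj.iterate k ((hbk k).trans h.symm)
  have hafix : ∀ k, a (c^[k] x) = c^[k] x ↔ N ∣ (k + 1) + k := by
    intro k
    rw [← hper, Function.iterate_add_apply]
    constructor
    · intro h
      have := hak k
      rwa [h] at this
    · intro h
      exact hinj.iterate (k + 1) ((hak k).trans h.symm)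
  have hmod : ∀ m, c^[m % N] x = c^[m] x := fun m => Function.iterate_mod_minimalPeriod_eq
  have hbex : ∀ k, ∃ m, b (c^[k] x) = c^[m] x := by
    intro k
    refine ⟨k * (N - 1), hinj.iterate k ?_⟩
    rw [hbk, ← Function.iterate_add_apply]
    refine ((hper _).2 ⟨k, ?_⟩).symm
    obtain ⟨N', hN'⟩ : ∃ N', N = N' + 1 := ⟨N - 1, by omega⟩
    rw [hN']; simp; ring
  have haex : ∀ k, ∃ m, a (c^[k] x) = c^[m] x := by
    intro k
    refine ⟨(k + 1) * (N - 1), hinj.iterate (k + 1) ?_⟩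
    rw [hak, ← Function.iterate_add_apply]
    refine ((hper _).2 ⟨k + 1, ?_⟩).symm
    obtain ⟨N', hN'⟩ : ∃ N', N = N' + 1 := ⟨N - 1, by omega⟩
    rw [hN']; simp; ring
  have hstep : ∀ v w, (w = v ∨ w = a v ∨ w = b v) → (∃ m, v = c^[m] x) → ∃ m, w = c^[m] x := by
    rintro v w (rfl | rfl | rfl) ⟨m, rfl⟩
    · exact ⟨m, rfl⟩
    · exact haex m
    · exact hbex m
  have horb : ∀ w, Relation.EqvGen r x w → ∃ m, w = c^[m] x := by
    intro w h
    have := eqvGen_lift (fun v w : V => (∃ m, v = c^[m] x) ↔ ∃ m, w = c^[m] x)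
      ⟨fun _ => Iff.rfl, Iff.symm, Iff.trans⟩ id (fun v w h => by
        refine ⟨hstep v w (hr v w h), hstep w v ?_⟩
        rcases hr v w h with h | h | h
        · exact Or.inl h.symm
        · exact Or.inr (Or.inl (by rw [h, ha]))
        · exact Or.inr (Or.inr (by rw [h, hb]))) h
    exact this.1 ⟨0, rfl⟩
  have horb' : ∀ m, Relation.EqvGen r x (c^[m] x) := by
    intro m
    induction m with
    | zero => exact .refl _
    | succ m ih =>
      rw [Function.iterate_succ_apply']
      exact .trans _ _ _ ih (.trans _ _ _ (hra _) (hrb _))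
  have huniq : ∀ y, y ≠ x ∧ (a y = y ∨ b y = y) ∧ Relation.EqvGen r x y → y = c^[N / 2] x := by
    rintro y ⟨hy, hfix, ho⟩
    obtain ⟨m, rfl⟩ := horb y ho
    rw [← hmod m] at hfix hy ⊢
    have hlt : m % N < N := Nat.mod_lt _ hNpos
    generalize m % N = k at *
    have hk : k ≠ 0 := by rintro rfl; exact hy rfl
    rw [hafix, hbfix] at hfix
    have : k = N / 2 := by
      rcases hfix with ⟨q, hq⟩ | ⟨q, hq⟩
      · have hq1 : q = 1 := by
          have h1 : 0 < q := Nat.pos_of_ne_zero (by rintro rfl; omega)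
          have h2 : q < 2 := by
            by_contra h; push Not at h
            have := Nat.mul_le_mul_left N h
            omega
          omega
        subst hq1; omega
      · have hq1 : q = 1 := by
          have h1 : 0 < q := Nat.pos_of_ne_zero (by rintro rfl; omega)
          have h2 : q < 2 := by
            by_contra h; push Not at h
            have := Nat.mul_le_mul_left N h
            omega
          omega
        subst hq1; omega
    rw [this]
  refine ⟨c^[N / 2] x, ⟨?_, ?_, horb' _⟩, huniq⟩
  · intro h
    have := Nat.le_of_dvd (by omega) ((hper _).1 h)
    omega
  · rw [hafix, hbfix]
    rcases Nat.even_or_odd' N with ⟨q, hq | hq⟩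
    · exact Or.inr ⟨1, by omega⟩
    · exact Or.inl ⟨1, by omega⟩

theorem IsBrauer.one : (1 : PartitionMonoid n).IsBrauer := by
  rw [isBrauer_iff]
  intro x
  refine ⟨x.swap, ⟨?_, ?_⟩, ?_⟩
  · rcases x with x | x <;> simp
  · rcases x with x | x <;> simp [one_same]
  · rintro (y | y) ⟨hy, h⟩ <;> rcases x with x | x <;> simp_all [one_same]

theorem IsBrauer.mul {α β : PartitionMonoid n} (hα : α.IsBrauer) (hβ : β.IsBrauer) :
    (α * β).IsBrauer := by
  rw [isBrauer_iff] at *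
  choose f hf hfu using hα
  choose g hg hgu using hβ
  have hff : Function.Involutive f := fun x =>
    (hfu (f x) x ⟨(hf x).1.symm, (hf x).2.symm⟩).symm
  have hgg : Function.Involutive g := fun x =>
    (hgu (g x) x ⟨(hg x).1.symm, (hg x).2.symm⟩).symm
  let a : Pin₃ n → Pin₃ n := Sum.elim (fun l => fst (f (Sum.inl l)))
    (Sum.elim (fun m => fst (f (Sum.inr m))) (fun k => Sum.inr (Sum.inr k)))
  let b : Pin₃ n → Pin₃ n := Sum.elim Sum.inl (fun p => snd (g p))
  have hfst : Function.Injective (fst (n := n)) :=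
    Function.Injective.sumMap Function.injective_id Sum.inl_injective
  have hout : Function.Injective (outer (n := n)) :=
    Function.Injective.sumMap Function.injective_id Sum.inr_injective
  have hafst : ∀ p, a (fst p) = fst (f p) := by rintro (p | p) <;> rfl
  have hbsnd : ∀ p, b (snd p) = snd (g p) := fun _ => rfl
  have hcov : ∀ v : Pin₃ n, (∃ p, v = fst p) ∨ ∃ k, v = Sum.inr (Sum.inr k) := by
    rintro (v | v | v)
    · exact Or.inl ⟨Sum.inl v, rfl⟩
    · exact Or.inl ⟨Sum.inr v, rfl⟩
    · exact Or.inr ⟨v, rfl⟩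
  have hainv : Function.Involutive a := by
    intro v
    rcases hcov v with ⟨p, rfl⟩ | ⟨k, rfl⟩
    · rw [hafst, hafst, hff]
    · rfl
  have hbinv : Function.Involutive b := by
    rintro (v | v)
    · rfl
    · change b (b (snd v)) = snd v
      rw [hbsnd, hbsnd, hgg]
  have hafix : ∀ v, a v = v ↔ ∃ k, v = Sum.inr (Sum.inr k) := by
    intro v
    rcases hcov v with ⟨p, rfl⟩ | ⟨k, rfl⟩
    · rw [hafst]
      refine ⟨fun h => ((hf p).1 (hfst h)).elim, ?_⟩
      rintro ⟨k, hk⟩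
      rcases p with p | p <;> simp [fst] at hk
    · exact ⟨fun _ => ⟨k, rfl⟩, fun _ => rfl⟩
  have hbfix : ∀ v, b v = v ↔ ∃ k, v = Sum.inl k := by
    rintro (v | v)
    · exact ⟨fun _ => ⟨v, rfl⟩, fun _ => rfl⟩
    · refine ⟨fun h => ((hg v).1 (Sum.inr_injective h)).elim, ?_⟩
      rintro ⟨k, hk⟩
      simp at hk
  have hr : ∀ v w, Link α β v w → w = v ∨ w = a v ∨ w = b v := by
    intro v w h
    cases h with
    | @left x y h =>
      by_cases hxy : y = x
      · exact Or.inl (by rw [hxy])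
      · exact Or.inr (Or.inl (by rw [hafst, hfu x y ⟨hxy, h⟩]))
    | @right x y h =>
      by_cases hxy : y = x
      · exact Or.inl (by rw [hxy])
      · exact Or.inr (Or.inr (by rw [hbsnd, hgu x y ⟨hxy, h⟩]))
  have hra : ∀ v, Conn α β v (a v) := by
    intro v
    rcases hcov v with ⟨p, rfl⟩ | ⟨k, rfl⟩
    · rw [hafst]; exact .rel _ _ (.left (hf p).2)
    · exact .refl _
  have hrb : ∀ v, Conn α β v (b v) := by
    rintro (v | v)
    · exact .refl _
    · exact .rel _ _ (.right (hg v).2)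
  have hfixout : ∀ v, (a v = v ∨ b v = v) ↔ ∃ p, v = outer p := by
    intro v
    rw [hafix, hbfix]
    constructor
    · rintro (⟨k, rfl⟩ | ⟨k, rfl⟩)
      · exact ⟨Sum.inr k, rfl⟩
      · exact ⟨Sum.inl k, rfl⟩
    · rintro ⟨p | p, rfl⟩
      · exact Or.inr ⟨p, rfl⟩
      · exact Or.inl ⟨p, rfl⟩
  intro x
  have key : ∃! v, v ≠ outer x ∧ (a v = v ∨ b v = v) ∧ Conn α β (outer x) v := by
    rcases x with x | x
    · refine existsUnique_fixed hainv hbinv hr hra hrb rfl ?_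
      rw [Ne, hafix]
      rintro ⟨k, hk⟩
      simp [outer] at hk
    · have := existsUnique_fixed hbinv hainv (fun v w h => (hr v w h).imp id Or.symm) hrb hra
        (x := outer (Sum.inr x)) rfl (by
          rw [Ne, hbfix]
          rintro ⟨k, hk⟩
          simp [outer] at hk)
      simpa only [Conn, or_comm] using this
  obtain ⟨v, ⟨hv, hvf, hvc⟩, hu⟩ := key
  obtain ⟨y, rfl⟩ := (hfixout v).1 hvf
  refine ⟨y, ⟨fun h => hv (by rw [h]), hvc⟩, ?_⟩
  rintro z ⟨hz, hzc⟩
  exact hout (hu (outer z) ⟨fun h => hz (hout h), (hfixout _).2 ⟨z, rfl⟩, hzc⟩)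

/-- The decomposition with blocks `{k, (g k)'}`; this identifies `S_n` (acting on `{1, …, n}` from
the right) with the set of all decompositions whose blocks are lines. -/
def ofPerm (g : Equiv.Perm (Fin n)) : PartitionMonoid n := ofFibres (Sum.elim g id)

/-- The index `i` as one of the indices `1, …, n`, for `i` one of the indices `1, …, n - 1`. -/
def idx (i : Fin (n - 1)) : Fin n := ⟨i, by omega⟩

/-- The index `i + 1` as one of the indices `1, …, n`, for `i` one of the indices
`1, …, n - 1`. -/
def idxSucc (i : Fin (n - 1)) : Fin n := ⟨i + 1, by omega⟩

/-- The elementary transposition `s_i = (i, i + 1)`. -/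
def s (i : Fin (n - 1)) : PartitionMonoid n := ofPerm (Equiv.swap (idx i) (idxSucc i))

/-- The elementary atom `π_i`, with blocks `{i, i + 1}`, `{i', (i + 1)'}` and `{j, j'}` for
`j ≠ i, i + 1`. -/
def atom (i : Fin (n - 1)) : PartitionMonoid n :=
  ofFibres (ι := Pin n) (Sum.elim
    (fun j => if j = idx i ∨ j = idxSucc i then Sum.inl (idx i) else Sum.inl j)
    (fun j => if j = idx i ∨ j = idxSucc i then Sum.inr (idx i) else Sum.inl j))

end PartitionMonoid

/-- The Brauer monoid `𝔅_n`: all decompositions of `M ∪ M'` whose blocks are lines or brackets,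
with the multiplication of `ℭ_n`. -/
def BrauerMonoid (n : ℕ) : Submonoid (PartitionMonoid n) where
  carrier := {α | α.IsBrauer}
  one_mem' := PartitionMonoid.IsBrauer.one
  mul_mem' := PartitionMonoid.IsBrauer.mul

namespace BrauerPresentation

/-- The generators `σ_i` and `θ_i`, where `i` runs through `n - 1` indices. -/
inductive Gen (n : ℕ) : Type
  | sigma (i : Fin (n - 1)) : Gen n
  | theta (i : Fin (n - 1)) : Gen n

variable {n : ℕ}

/-- The one-letter word `σ_i`. -/
def σ (i : Fin (n - 1)) : FreeMonoid (Gen n) := FreeMonoid.of (Gen.sigma i)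

/-- The one-letter word `θ_i`. -/
def θ (i : Fin (n - 1)) : FreeMonoid (Gen n) := FreeMonoid.of (Gen.theta i)

/-- `|i - j| = 1`. -/
def Near (i j : Fin (n - 1)) : Prop := (i : ℕ) + 1 = j ∨ (j : ℕ) + 1 = i

/-- `|i - j| > 1`. -/
def Far (i j : Fin (n - 1)) : Prop := (i : ℕ) + 1 < j ∨ (j : ℕ) + 1 < i

/-- The defining relations. -/
inductive Rel (n : ℕ) : FreeMonoid (Gen n) → FreeMonoid (Gen n) → Prop
  | sigma_sq (i : Fin (n - 1)) : Rel n (σ i * σ i) 1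
  | sigma_comm (i j : Fin (n - 1)) : Far i j → Rel n (σ i * σ j) (σ j * σ i)
  | sigma_braid (i j : Fin (n - 1)) : Near i j → Rel n (σ i * σ j * σ i) (σ j * σ i * σ j)
  | theta_sq (i : Fin (n - 1)) : Rel n (θ i * θ i) (θ i)
  | theta_comm (i j : Fin (n - 1)) : Far i j → Rel n (θ i * θ j) (θ j * θ i)
  | theta_theta_theta (i j : Fin (n - 1)) : Near i j → Rel n (θ i * θ j * θ i) (θ i)
  | theta_sigma (i : Fin (n - 1)) : Rel n (θ i * σ i) (θ i)
  | sigma_theta (i : Fin (n - 1)) : Rel n (σ i * θ i) (θ i)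
  | theta_sigma_comm (i j : Fin (n - 1)) : Far i j → Rel n (θ i * σ j) (σ j * θ i)
  | sigma_theta_theta (i j : Fin (n - 1)) : Near i j → Rel n (σ i * θ j * θ i) (σ j * θ i)
  | theta_theta_sigma (i j : Fin (n - 1)) : Near i j → Rel n (θ i * θ j * σ i) (θ i * σ j)

/-- The monoid `T` generated by the `σ_i` and `θ_i` subject to the defining relations. -/
abbrev T (n : ℕ) : Type := PresentedMonoid (Rel n)

end BrauerPresentation

/-! The relations hold for the partitions, so there is a homomorphism from `T n`; the question is
why it is bijective. Number the pins from 0. The submonoid `initial σ θ m` generated by the first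
`m` pairs of generators should be a copy of the Brauer monoid on the first `m + 1` points, and the
proof climbs from `m` to `m + 1`.

In a Brauer partition of `m + 2` points the left pin `m + 1` has `2 * m + 3` possible partners: a
right pin `k'` with `k ≤ m + 1`, or a left pin `k` with `k ≤ m`. To each partner belongs one family
of words: `h * down σ k r` for a line to `k'`, and `up σ k r * θ m * h` for a bracket with `k`,
where `h` lies in `initial σ θ m`. By `isNormal_of_mem` the relations suffice to bring every element
of `initial σ θ (m + 1)` into one of these forms: the set of normal forms contains 1 and is closed
under right multiplication by the generators.

On the side of partitions, the partner of `m + 1` reveals the family and `k`. The factors `down` and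
`up` are invertible, and `h` can be recovered from the product of the atom with its image, because
the image of `h` has the block `{m + 1, (m + 1)'}` (`relabel_atomOf_mul`). Injectivity
(`toPartition_injOn`) and surjectivity (`exists_toPartition_eq`) follow by induction on `m`. -/

/-! ### Consequences of the Brauer relations in an arbitrary monoid. -/

/-- Two sequences of elements of a monoid of which the first `N` terms satisfy the defining
relations of the Brauer monoid. -/
structure BrauerSystem {X : Type*} [Monoid X] (N : ℕ) (σ θ : ℕ → X) : Prop where
  sigma_sq : ∀ i, i < N → σ i * σ i = 1
  sigma_comm : ∀ i j, i < N → j < N → i + 1 < j ∨ j + 1 < i → σ i * σ j = σ j * σ i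
  sigma_braid : ∀ i j, i < N → j < N → i + 1 = j ∨ j + 1 = i →
    σ i * σ j * σ i = σ j * σ i * σ j
  theta_sq : ∀ i, i < N → θ i * θ i = θ i
  theta_comm : ∀ i j, i < N → j < N → i + 1 < j ∨ j + 1 < i → θ i * θ j = θ j * θ i
  theta_theta_theta : ∀ i j, i < N → j < N → i + 1 = j ∨ j + 1 = i → θ i * θ j * θ i = θ i
  theta_sigma : ∀ i, i < N → θ i * σ i = θ i
  sigma_theta : ∀ i, i < N → σ i * θ i = θ i
  theta_sigma_comm : ∀ i j, i < N → j < N → i + 1 < j ∨ j + 1 < i → θ i * σ j = σ j * θ i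
  sigma_theta_theta : ∀ i j, i < N → j < N → i + 1 = j ∨ j + 1 = i →
    σ i * θ j * θ i = σ j * θ i
  theta_theta_sigma : ∀ i j, i < N → j < N → i + 1 = j ∨ j + 1 = i →
    θ i * θ j * σ i = θ i * σ j

namespace BrauerSystem

variable {X : Type*} [Monoid X]

/-- The submonoid generated by the first `m` terms of the two sequences. -/
def initial (σ θ : ℕ → X) (m : ℕ) : Submonoid X :=
  Submonoid.closure {x | ∃ i < m, x = σ i ∨ x = θ i}

/-- The product `σ k * σ (k + 1) * ⋯ * σ (k + r - 1)`. -/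
def up (σ : ℕ → X) (k : ℕ) : ℕ → X
  | 0 => 1
  | r + 1 => up σ k r * σ (k + r)

/-- The product `σ (k + r - 1) * ⋯ * σ (k + 1) * σ k`. -/
def down (σ : ℕ → X) (k : ℕ) : ℕ → X
  | 0 => 1
  | r + 1 => σ (k + r) * down σ k r

/-- The elements that arise from `initial σ θ m` by one of the standard multiplications. -/
def IsNormal (σ θ : ℕ → X) (m : ℕ) (x : X) : Prop :=
  (∃ k r, k + r = m + 1 ∧ ∃ h ∈ initial σ θ m, x = h * down σ k r) ∨
    ∃ k r, k + r = m ∧ ∃ h ∈ initial σ θ m, x = up σ k r * θ m * h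

theorem initial_mono (σ θ : ℕ → X) {m m' : ℕ} (h : m ≤ m') :
    initial σ θ m ≤ initial σ θ m' :=
  Submonoid.closure_mono fun _ ⟨i, hi, hx⟩ => ⟨i, hi.trans_le h, hx⟩

theorem sigma_mem (σ θ : ℕ → X) {i m : ℕ} (h : i < m) : σ i ∈ initial σ θ m :=
  Submonoid.subset_closure ⟨i, h, Or.inl rfl⟩

theorem theta_mem (σ θ : ℕ → X) {i m : ℕ} (h : i < m) : θ i ∈ initial σ θ m :=
  Submonoid.subset_closure ⟨i, h, Or.inr rfl⟩

theorem up_mem (σ θ : ℕ → X) (k r : ℕ) {m : ℕ} (h : k + r ≤ m) :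
    up σ k r ∈ initial σ θ m := by
  induction r with
  | zero => exact one_mem _
  | succ r ih => exact mul_mem (ih (by omega)) (sigma_mem σ θ (by omega))

theorem down_mem (σ θ : ℕ → X) (k r : ℕ) {m : ℕ} (h : k + r ≤ m) :
    down σ k r ∈ initial σ θ m := by
  induction r with
  | zero => exact one_mem _
  | succ r ih => exact mul_mem (sigma_mem σ θ (by omega)) (ih (by omega))

theorem eq_one_of_mem_initial_zero {σ θ : ℕ → X} {x : X} (h : x ∈ initial σ θ 0) : x = 1 := by
  have : initial σ θ 0 = ⊥ := by
    unfold initial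
    rw [← le_bot_iff, Submonoid.closure_le]
    rintro _ ⟨i, hi, _⟩
    omega
  rwa [this, Submonoid.mem_bot] at h

theorem down_succ_right (σ : ℕ → X) (k r : ℕ) :
    down σ k (r + 1) = down σ (k + 1) r * σ k := by
  induction r with
  | zero => simp [down]
  | succ r ih =>
    rw [down, ih, down, mul_assoc, show k + 1 + r = k + (r + 1) by ring]

variable {N : ℕ} {σ θ : ℕ → X}

/-- The list of relations is invariant under reversing words: those with θ and σ on opposite sides
are exchanged in pairs. This makes every statement about right multiplication available for left
multiplication. -/
theorem op (S : BrauerSystem N σ θ) :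
    BrauerSystem N (fun i => MulOpposite.op (σ i)) (fun i => MulOpposite.op (θ i)) := by
  constructor <;> intro i <;> simp only [← MulOpposite.op_mul, ← mul_assoc]
  · intro h; rw [S.sigma_sq i h, MulOpposite.op_one]
  · intro j h h' hf; rw [S.sigma_comm i j h h' hf]
  · intro j h h' hf; rw [S.sigma_braid i j h h' hf]
  · intro h; rw [S.theta_sq i h]
  · intro j h h' hf; rw [S.theta_comm i j h h' hf]
  · intro j h h' hf; rw [S.theta_theta_theta i j h h' hf]
  · intro h; rw [S.sigma_theta i h]
  · intro h; rw [S.theta_sigma i h]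
  · intro j h h' hf; rw [S.theta_sigma_comm i j h h' hf]
  · intro j h h' hf; rw [S.theta_theta_sigma i j h h' hf]
  · intro j h h' hf; rw [S.sigma_theta_theta i j h h' hf]

theorem op_up (σ : ℕ → X) (k r : ℕ) :
    up (fun i => MulOpposite.op (σ i)) k r = MulOpposite.op (down σ k r) := by
  induction r with
  | zero => rfl
  | succ r ih => rw [up, ih, down, MulOpposite.op_mul]

theorem op_down (σ : ℕ → X) (k r : ℕ) :
    down (fun i => MulOpposite.op (σ i)) k r = MulOpposite.op (up σ k r) := by
  induction r with
  | zero => rfl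
  | succ r ih => rw [up, down, ih, MulOpposite.op_mul]

theorem op_mem_initial_iff (σ θ : ℕ → X) (m : ℕ) (x : X) :
    MulOpposite.op x ∈
      initial (fun i => MulOpposite.op (σ i)) (fun i => MulOpposite.op (θ i)) m ↔
    x ∈ initial σ θ m := by
  have : initial (fun i => MulOpposite.op (σ i)) (fun i => MulOpposite.op (θ i)) m =
      (initial σ θ m).op := by
    unfold initial
    rw [Submonoid.op_closure]
    congr 1
    ext y
    simp [← MulOpposite.unop_inj]
  rw [this]
  exact Iff.rfl

/-- The generators of `initial σ θ m` have indices below `m`, so the strict inequality `m < j` keeps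
them at distance more than 1 from `j`. -/
theorem commute_sigma (S : BrauerSystem N σ θ) {m j : ℕ} (hm : m < j) (hj : j < N) {h : X}
    (hh : h ∈ initial σ θ m) : Commute h (σ j) := by
  induction hh using Submonoid.closure_induction with
  | mem x hx =>
    obtain ⟨i, hi, rfl | rfl⟩ := hx
    · exact S.sigma_comm i j (by omega) hj (by omega)
    · exact S.theta_sigma_comm i j (by omega) hj (by omega)
  | one => exact Commute.one_left _
  | mul x y _ _ hx hy => exact hx.mul_left hy

theorem commute_theta (S : BrauerSystem N σ θ) {m j : ℕ} (hm : m < j) (hj : j < N) {h : X}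
    (hh : h ∈ initial σ θ m) : Commute h (θ j) := by
  induction hh using Submonoid.closure_induction with
  | mem x hx =>
    obtain ⟨i, hi, rfl | rfl⟩ := hx
    · exact (S.theta_sigma_comm j i hj (by omega) (by omega)).symm
    · exact S.theta_comm i j (by omega) hj (by omega)
  | one => exact Commute.one_left _
  | mul x y _ _ hx hy => exact hx.mul_left hy

theorem up_mul_down (S : BrauerSystem N σ θ) (k r : ℕ) (h : k + r ≤ N) :
    up σ k r * down σ k r = 1 := by
  induction r with
  | zero => exact one_mul _
  | succ r ih =>
    rw [up, down, mul_assoc, ← mul_assoc (σ _), S.sigma_sq _ (by omega), one_mul, ih (by omega)]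

theorem down_mul_up (S : BrauerSystem N σ θ) (k r : ℕ) (h : k + r ≤ N) :
    down σ k r * up σ k r = 1 := by
  induction r with
  | zero => exact one_mul _
  | succ r ih =>
    rw [up, down, mul_assoc, ← mul_assoc (down σ k r), ih (by omega), one_mul,
      S.sigma_sq _ (by omega)]

/-- The products `θ i * θ j` of neighbours. -/
theorem theta_mul_theta (S : BrauerSystem N σ θ) {i j : ℕ} (hi : i < N) (hj : j < N)
    (hij : i + 1 = j ∨ j + 1 = i) : θ i * θ j = θ i * σ j * σ i := by
  rw [← S.theta_theta_sigma i j hi hj hij, mul_assoc _ (σ i), S.sigma_sq i hi, mul_one]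

/-- Both sides equal `θ j * θ i`. In effect `σ i * σ j` conjugates `θ i` into `θ j`, so that all θ's
are conjugate. -/
theorem sigma_sigma_theta (S : BrauerSystem N σ θ) {i j : ℕ} (hi : i < N) (hj : j < N)
    (hij : i + 1 = j ∨ j + 1 = i) : σ i * σ j * θ i = θ j * σ i * σ j := by
  rw [← S.theta_mul_theta hj hi hij.symm, mul_assoc, ← S.sigma_theta_theta i j hi hj hij,
    mul_assoc, ← mul_assoc, S.sigma_sq i hi, one_mul]

theorem theta_sigma_theta (S : BrauerSystem N σ θ) {i j : ℕ} (hi : i < N) (hj : j < N)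
    (hij : i + 1 = j ∨ j + 1 = i) : θ i * σ j * θ i = θ i := by
  rw [← S.theta_theta_sigma i j hi hj hij, mul_assoc, S.sigma_theta i hi,
    S.theta_theta_theta i j hi hj hij]

theorem down_mul_sigma_of_lt (S : BrauerSystem N σ θ) {i k r : ℕ} (h : i + 1 < k)
    (hr : k + r ≤ N) : Commute (down σ k r) (σ i) := by
  induction r with
  | zero => exact Commute.one_left _
  | succ r ih =>
    exact Commute.mul_left (S.sigma_comm _ _ (by omega) (by omega) (by omega)) (ih (by omega))

/-- The descending product represents a cycle, and conjugation by it shifts indices by one. The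
leading factor commutes with `σ i` unless `i + 1` is the top index, and there the braid relation
does the shift. -/
theorem down_mul_sigma_of_mem (S : BrauerSystem N σ θ) {i k r : ℕ} (h : k ≤ i)
    (hi : i + 1 < k + r) (hr : k + r ≤ N) : down σ k r * σ (i + 1) = σ i * down σ k r := by
  induction r with
  | zero => omega
  | succ r ih =>
    by_cases hir : i + 1 < k + r
    · rw [down, mul_assoc, ih hir (by omega), ← mul_assoc, ← mul_assoc,
        S.sigma_comm _ i (by omega) (by omega) (by omega)]
    · obtain ⟨t, rfl⟩ : ∃ t, r = t + 1 := ⟨r - 1, by omega⟩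
      obtain rfl : i = k + t := by omega
      rw [down, down, ← add_assoc]
      have hc := S.commute_sigma (m := k + t) (j := k + t + 1) (by omega) (by omega)
        (down_mem σ θ k t le_rfl)
      rw [mul_assoc, mul_assoc, hc.eq, ← mul_assoc, ← mul_assoc, ← mul_assoc,
        S.sigma_braid (k + t + 1) (k + t) (by omega) (by omega) (by omega)]
      simp only [mul_assoc]

/-! ### Reduction to normal form. -/

/-- The normal forms that the mirror image of `IsNormal` provides. -/
def IsConormal (σ θ : ℕ → X) (m : ℕ) (x : X) : Prop :=
  (∃ k r, k + r = m + 1 ∧ ∃ h ∈ initial σ θ m, x = up σ k r * h) ∨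
    ∃ k r, k + r = m ∧ ∃ h ∈ initial σ θ m, x = h * θ m * down σ k r

theorem isConormal_of_isNormal_op {m : ℕ} {x : X}
    (h : IsNormal (fun i => MulOpposite.op (σ i)) (fun i => MulOpposite.op (θ i)) m
      (MulOpposite.op x)) : IsConormal σ θ m x := by
  rcases h with ⟨k, r, hk, h, hh, hx⟩ | ⟨k, r, hk, h, hh, hx⟩
  · induction h using MulOpposite.rec' with | _ h => ?_
    refine Or.inl ⟨k, r, hk, h, (op_mem_initial_iff σ θ m h).1 hh, ?_⟩
    rwa [op_down, ← MulOpposite.op_mul, MulOpposite.op_inj] at hx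
  · induction h using MulOpposite.rec' with | _ h => ?_
    refine Or.inr ⟨k, r, hk, h, (op_mem_initial_iff σ θ m h).1 hh, ?_⟩
    rwa [op_up, ← MulOpposite.op_mul, ← MulOpposite.op_mul, MulOpposite.op_inj,
      ← mul_assoc] at hx

/-- Elements of `θ m * initial σ θ m` remain there under multiplication by `σ m` and `θ m`. -/
theorem theta_mul_mul (S : BrauerSystem N σ θ) {m : ℕ} (hm : m < N)
    (hR : ∀ m', m = m' + 1 → ∀ x ∈ initial σ θ m, IsNormal σ θ m' x) {h : X}
    (hh : h ∈ initial σ θ m) :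
    (∃ h' ∈ initial σ θ m, θ m * h * σ m = θ m * h') ∧
      ∃ h' ∈ initial σ θ m, θ m * h * θ m = θ m * h' := by
  rcases m with _ | m
  · rw [eq_one_of_mem_initial_zero hh, mul_one, S.theta_sigma 0 hm, S.theta_sq 0 hm]
    exact ⟨⟨1, one_mem _, (mul_one _).symm⟩, ⟨1, one_mem _, (mul_one _).symm⟩⟩
  have hle : initial σ θ m ≤ initial σ θ (m + 1) := initial_mono σ θ (by omega)
  have hθ : θ m ∈ initial σ θ (m + 1) := theta_mem σ θ (by omega)
  have hσ : σ m ∈ initial σ θ (m + 1) := sigma_mem σ θ (by omega)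
  -- The normal form of `h` one level down isolates its only factors that fail to commute with the
  -- last generators, `σ m` or `θ m`; everything else moves past `σ (m + 1)` and `θ (m + 1)`.
  rcases hR m rfl h hh with ⟨k, r, hk, g, hg, rfl⟩ | ⟨k, r, hk, g, hg, rfl⟩
  · have hgθ := S.commute_theta (Nat.lt_succ_self m) hm hg
    rcases r with _ | r
    · rw [down, mul_one, ← hgθ.eq, mul_assoc, S.theta_sigma _ hm, mul_assoc, S.theta_sq _ hm,
        hgθ.eq]
      exact ⟨⟨g, hle hg, rfl⟩, ⟨g, hle hg, rfl⟩⟩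
    · obtain rfl : k + r = m := by omega
      have hd := down_mem σ θ k r le_rfl
      have hdσ := S.commute_sigma (Nat.lt_succ_self (k + r)) hm hd
      have hdθ := S.commute_theta (Nat.lt_succ_self (k + r)) hm hd
      refine ⟨⟨g * (θ (k + r) * down σ k r), mul_mem (hle hg) (mul_mem hθ (hle hd)), ?_⟩,
        ⟨g * down σ k r, mul_mem (hle hg) (hle hd), ?_⟩⟩
      · calc θ (k + r + 1) * (g * down σ k (r + 1)) * σ (k + r + 1)
            = θ (k + r + 1) * g * σ (k + r) * (down σ k r * σ (k + r + 1)) := by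
              simp only [down, mul_assoc]
          _ = g * (θ (k + r + 1) * σ (k + r) * σ (k + r + 1)) * down σ k r := by
              rw [hdσ.eq, ← hgθ.eq]; simp only [mul_assoc]
          _ = g * θ (k + r + 1) * θ (k + r) * down σ k r := by
              rw [← S.theta_mul_theta hm (by omega) (by omega)]; simp only [mul_assoc]
          _ = _ := by rw [hgθ.eq]; simp only [mul_assoc]
      · calc θ (k + r + 1) * (g * down σ k (r + 1)) * θ (k + r + 1)
            = θ (k + r + 1) * g * σ (k + r) * (down σ k r * θ (k + r + 1)) := by
              simp only [down, mul_assoc]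
          _ = g * (θ (k + r + 1) * σ (k + r) * θ (k + r + 1)) * down σ k r := by
              rw [hdθ.eq, ← hgθ.eq]; simp only [mul_assoc]
          _ = g * θ (k + r + 1) * down σ k r := by
              rw [S.theta_sigma_theta hm (by omega) (by omega)]
          _ = _ := by rw [hgθ.eq]; simp only [mul_assoc]
  · have hgθ := S.commute_theta (Nat.lt_succ_self m) hm hg
    have hgσ := S.commute_sigma (Nat.lt_succ_self m) hm hg
    have hu := up_mem σ θ k r hk.le
    have huθ := S.commute_theta (Nat.lt_succ_self m) hm hu
    refine ⟨⟨up σ k r * (σ m * g), mul_mem (hle hu) (mul_mem hσ (hle hg)), ?_⟩,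
      ⟨up σ k r * g, mul_mem (hle hu) (hle hg), ?_⟩⟩
    · calc θ (m + 1) * (up σ k r * θ m * g) * σ (m + 1)
          = θ (m + 1) * up σ k r * θ m * (g * σ (m + 1)) := by simp only [mul_assoc]
        _ = up σ k r * (θ (m + 1) * θ m * σ (m + 1)) * g := by
            rw [hgσ.eq, ← huθ.eq]; simp only [mul_assoc]
        _ = up σ k r * θ (m + 1) * σ m * g := by
            rw [S.theta_theta_sigma _ _ hm (by omega) (by omega)]; simp only [mul_assoc]
        _ = _ := by rw [huθ.eq]; simp only [mul_assoc]
    · calc θ (m + 1) * (up σ k r * θ m * g) * θ (m + 1)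
          = θ (m + 1) * up σ k r * θ m * (g * θ (m + 1)) := by simp only [mul_assoc]
        _ = up σ k r * (θ (m + 1) * θ m * θ (m + 1)) * g := by
            rw [hgθ.eq, ← huθ.eq]; simp only [mul_assoc]
        _ = up σ k r * θ (m + 1) * g := by
            rw [S.theta_theta_theta _ _ hm (by omega) (by omega)]
        _ = _ := by rw [huθ.eq]; simp only [mul_assoc]

/-- Here the factor to be moved past `θ m` stands at the right end of `h`, so the mirrored normal
form is the useful one. -/
theorem isNormal_mul_theta_last (S : BrauerSystem N σ θ) {m : ℕ} (hm : m < N)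
    (hL : ∀ m', m = m' + 1 → ∀ x ∈ initial σ θ m, IsConormal σ θ m' x) {h : X}
    (hh : h ∈ initial σ θ m) : IsNormal σ θ m (h * θ m) := by
  rcases m with _ | m
  · rw [eq_one_of_mem_initial_zero hh]
    exact Or.inr ⟨0, 0, rfl, 1, one_mem _, by simp [up]⟩
  have hle : initial σ θ m ≤ initial σ θ (m + 1) := initial_mono σ θ (by omega)
  rcases hL m rfl h hh with ⟨k, r, hk, g, hg, rfl⟩ | ⟨k, r, hk, g, hg, rfl⟩
  · refine Or.inr ⟨k, r, hk, g, hle hg, ?_⟩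
    rw [mul_assoc, (S.commute_theta (Nat.lt_succ_self m) hm hg).eq, ← mul_assoc]
  -- The word contains `θ m * θ (m + 1)`, which equals `θ m * σ (m + 1) * σ m`; the two new σ's
  -- extend `down σ k r` by two factors, and `θ m` is absorbed into the left factor.
  · refine Or.inl ⟨k, r + 2, by omega, g * θ m,
      mul_mem (hle hg) (theta_mem σ θ (by omega)), ?_⟩
    subst hk
    rw [mul_assoc, (S.commute_theta (Nat.lt_succ_self _) hm (down_mem σ θ k r le_rfl)).eq,
      ← mul_assoc, mul_assoc g, S.theta_mul_theta (by omega) hm (by omega)]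
    simp only [down, mul_assoc, add_assoc]

/-- For a line ending at `k'`, the factor `σ i` moves that end when `i = k - 1` or `i = k`, that is,
it lengthens or shortens the descending product; otherwise it passes through to the left factor,
with its index lowered by one if `i > k`. For a bracket only `i = m` needs work, and there
`theta_mul_mul` applies. -/
theorem IsNormal.mul_sigma (S : BrauerSystem N σ θ) {m : ℕ} (hm : m < N)
    (hR : ∀ m', m = m' + 1 → ∀ x ∈ initial σ θ m, IsNormal σ θ m' x) {x : X}
    (hx : IsNormal σ θ m x) {i : ℕ} (hi : i ≤ m) : IsNormal σ θ m (x * σ i) := by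
  rcases hx with ⟨k, r, hk, h, hh, rfl⟩ | ⟨k, r, hk, h, hh, rfl⟩
  · rcases lt_trichotomy (i + 1) k with hik | hik | hik
    · refine Or.inl ⟨k, r, hk, h * σ i, mul_mem hh (sigma_mem σ θ (by omega)), ?_⟩
      rw [mul_assoc, (S.down_mul_sigma_of_lt hik (by omega)).eq, mul_assoc]
    · subst hik
      exact Or.inl ⟨i, r + 1, by omega, h, hh, by rw [down_succ_right, mul_assoc]⟩
    · rcases eq_or_lt_of_le (Nat.lt_succ_iff.1 hik) with rfl | hki
      · obtain ⟨t, rfl⟩ : ∃ t, r = t + 1 := ⟨r - 1, by omega⟩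
        refine Or.inl ⟨k + 1, t, by omega, h, hh, ?_⟩
        rw [down_succ_right, mul_assoc, mul_assoc, S.sigma_sq k (by omega), mul_one]
      · obtain ⟨j, rfl⟩ : ∃ j, i = j + 1 := ⟨i - 1, by omega⟩
        refine Or.inl ⟨k, r, hk, h * σ j, mul_mem hh (sigma_mem σ θ (by omega)), ?_⟩
        rw [mul_assoc, S.down_mul_sigma_of_mem (by omega) (by omega) (by omega), mul_assoc]
  · rcases eq_or_lt_of_le hi with rfl | hi
    · obtain ⟨h', hh', he⟩ := (S.theta_mul_mul hm hR hh).1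
      refine Or.inr ⟨k, r, hk, h', hh', ?_⟩
      rw [mul_assoc, mul_assoc, ← mul_assoc (θ i), he, mul_assoc]
    · exact Or.inr ⟨k, r, hk, h * σ i, mul_mem hh (sigma_mem σ θ hi), mul_assoc _ _ _⟩

theorem IsNormal.mul_theta_last (S : BrauerSystem N σ θ) {m : ℕ} (hm : m < N)
    (hR : ∀ m', m = m' + 1 → ∀ x ∈ initial σ θ m, IsNormal σ θ m' x)
    (hL : ∀ m', m = m' + 1 → ∀ x ∈ initial σ θ m, IsConormal σ θ m' x) {x : X}
    (hx : IsNormal σ θ m x) : IsNormal σ θ m (x * θ m) := by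
  rcases hx with ⟨k, r, hk, h, hh, rfl⟩ | ⟨k, r, hk, h, hh, rfl⟩
  · match r, hk with
    | 0, _ =>
      rw [down, mul_one]
      exact S.isNormal_mul_theta_last hm hL hh
    | 1, hk =>
      obtain rfl : k = m := by omega
      rw [down, down, mul_one, mul_assoc, add_zero, S.sigma_theta k hm]
      exact S.isNormal_mul_theta_last hm hL hh
    -- Two factors of the descending product carry `θ` of the last index to `θ` of the index below,
    -- which lies in `initial`.
    | r + 2, hk =>
      obtain rfl : k + r + 1 = m := by omega
      refine Or.inl ⟨k, r + 2, hk, h * θ (k + r), mul_mem hh (theta_mem σ θ (by omega)), ?_⟩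
      have hc := S.commute_theta (Nat.lt_succ_self (k + r)) hm (down_mem σ θ k r le_rfl)
      calc h * down σ k (r + 2) * θ (k + r + 1)
          = h * (σ (k + r + 1) * σ (k + r) * (down σ k r * θ (k + r + 1))) := by
            simp only [down, mul_assoc, add_assoc]
        _ = h * (σ (k + r + 1) * σ (k + r) * θ (k + r + 1)) * down σ k r := by
            rw [hc.eq]; simp only [mul_assoc]
        _ = _ := by
            rw [S.sigma_sigma_theta hm (by omega) (by omega)]
            simp only [down, mul_assoc, add_assoc]
  · obtain ⟨h', hh', he⟩ := (S.theta_mul_mul hm hR hh).2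
    refine Or.inr ⟨k, r, hk, h', hh', ?_⟩
    rw [mul_assoc, mul_assoc, ← mul_assoc (θ m), he, mul_assoc]

theorem isNormal_of_mem_succ (S : BrauerSystem N σ θ) {m : ℕ} (hm : m < N)
    (hR : ∀ m', m = m' + 1 → ∀ x ∈ initial σ θ m, IsNormal σ θ m' x)
    (hL : ∀ m', m = m' + 1 → ∀ x ∈ initial σ θ m, IsConormal σ θ m' x) {x : X}
    (hx : x ∈ initial σ θ (m + 1)) : IsNormal σ θ m x := by
  have hσ : ∀ x i, i ≤ m → IsNormal σ θ m x → IsNormal σ θ m (x * σ i) :=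
    fun x i hi h => h.mul_sigma S hm hR hi
  -- Descending induction on the index `i`: the last θ is handled directly, and every other `θ i` is
  -- a conjugate of `θ (i + 1)` by σ's already dealt with.
  have hθ : ∀ t i, i + t = m → ∀ x, IsNormal σ θ m x → IsNormal σ θ m (x * θ i) := by
    intro t
    induction t with
    | zero =>
      rintro i rfl x h
      exact h.mul_theta_last S hm hR hL
    | succ t ih =>
      intro i hi x h
      have key : θ i = σ (i + 1) * σ i * θ (i + 1) * σ i * σ (i + 1) := by
        have h₁ : σ i * (σ (i + 1) * θ i) = θ (i + 1) * (σ i * σ (i + 1)) := by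
          simpa only [mul_assoc] using
            S.sigma_sigma_theta (i := i) (j := i + 1) (by omega) (by omega) (by omega)
        simp only [mul_assoc]
        rw [← h₁, ← mul_assoc (σ i), S.sigma_sq i (by omega), one_mul, ← mul_assoc,
          S.sigma_sq (i + 1) (by omega), one_mul]
      rw [key]
      simp only [← mul_assoc]
      exact hσ _ _ (by omega) (hσ _ _ (by omega) (ih _ (by omega) _
        (hσ _ _ (by omega) (hσ _ _ (by omega) h))))
  induction hx using Submonoid.closure_induction_right with
  | one => exact Or.inl ⟨m + 1, 0, rfl, 1, one_mem _, (mul_one _).symm⟩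
  | mul_right x _ y hy ih =>
    obtain ⟨i, hi, rfl | rfl⟩ := hy
    · exact hσ _ _ (by omega) ih
    · exact hθ (m - i) i (by omega) _ ih

/-- Every element of the submonoid generated by the first `m + 1` terms has a normal form. -/
theorem isNormal_of_mem {m : ℕ} : ∀ {X : Type*} [Monoid X] {σ θ : ℕ → X},
    BrauerSystem N σ θ → m < N → ∀ x ∈ initial σ θ (m + 1), IsNormal σ θ m x := by
  induction m with
  | zero =>
    intro X _ σ θ S hm x hx
    exact S.isNormal_of_mem_succ hm (fun m' h => by omega) (fun m' h => by omega) hx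
  | succ m ih =>
    intro X _ σ θ S hm x hx
    refine S.isNormal_of_mem_succ hm (fun m' h x hx => ?_) (fun m' h x hx => ?_) hx
    · obtain rfl : m = m' := by omega
      exact ih S (by omega) x hx
    · obtain rfl : m = m' := by omega
      -- The mirrored normal form is the induction hypothesis in the opposite monoid; this is why
      -- the statement ranges over all monoids.
      exact isConormal_of_isNormal_op
        (ih S.op (by omega) _ ((op_mem_initial_iff σ θ _ _).2 hx))

end BrauerSystem
-- Multiplication of permutations and atoms as partitions.
namespace PartitionMonoid

variable {n : ℕ}

section Composition

variable {α β : PartitionMonoid n} {i j k l : Fin n}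

theorem mul_same_inl_inl (h : α.Same (Sum.inl i) (Sum.inl j)) :
    (α * β).Same (Sum.inl i) (Sum.inl j) :=
  Relation.EqvGen.rel _ _ (Link.left h)

theorem mul_same_inr_inr (h : β.Same (Sum.inr i) (Sum.inr j)) :
    (α * β).Same (Sum.inr i) (Sum.inr j) :=
  Relation.EqvGen.rel _ _ (Link.right h)

theorem mul_same_inl_inr (h : α.Same (Sum.inl i) (Sum.inr j))
    (h' : β.Same (Sum.inl j) (Sum.inr k)) : (α * β).Same (Sum.inl i) (Sum.inr k) :=
  Relation.EqvGen.trans _ _ _ (.rel _ _ (Link.left h)) (.rel _ _ (Link.right h'))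

theorem mul_same_inl_inl_of_bracket (h : α.Same (Sum.inl i) (Sum.inr k))
    (hb : β.Same (Sum.inl k) (Sum.inl l)) (h' : α.Same (Sum.inl j) (Sum.inr l)) :
    (α * β).Same (Sum.inl i) (Sum.inl j) :=
  Relation.EqvGen.trans _ _ _ (.rel _ _ (Link.left h))
    (.trans _ _ _ (.rel _ _ (Link.right hb)) (.rel _ _ (Link.left h'.symm)))

theorem mul_same_inr_inr_of_bracket (h : β.Same (Sum.inl k) (Sum.inr i))
    (hb : α.Same (Sum.inr k) (Sum.inr l)) (h' : β.Same (Sum.inl l) (Sum.inr j)) :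
    (α * β).Same (Sum.inr i) (Sum.inr j) :=
  Relation.EqvGen.trans _ _ _ (.rel _ _ (Link.right h.symm))
    (.trans _ _ _ (.rel _ _ (Link.left hb)) (.rel _ _ (Link.right h')))

theorem mul_same_inl_inr_of_brackets (h : α.Same (Sum.inl i) (Sum.inr j))
    (hb : β.Same (Sum.inl j) (Sum.inl k)) (hb' : α.Same (Sum.inr k) (Sum.inr l))
    {p : Fin n} (h' : β.Same (Sum.inl l) (Sum.inr p)) : (α * β).Same (Sum.inl i) (Sum.inr p) :=
  Relation.EqvGen.trans _ _ _ (.rel _ _ (Link.left h)) (.trans _ _ _ (.rel _ _ (Link.right hb))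
    (.trans _ _ _ (.rel _ _ (Link.left hb')) (.rel _ _ (Link.right h'))))

end Composition

theorem IsBrauer.eq_of_same {α : PartitionMonoid n} (hα : α.IsBrauer) {x y z : Pin n}
    (hy : y ≠ x) (hz : z ≠ x) (hxy : α.Same x y) (hxz : α.Same x z) : y = z :=
  ((isBrauer_iff α).1 hα x).unique ⟨hy, hxy⟩ ⟨hz, hxz⟩

theorem IsBrauer.exists_same {α : PartitionMonoid n} (hα : α.IsBrauer) (x : Pin n) :
    ∃ y, y ≠ x ∧ α.Same x y :=
  ((isBrauer_iff α).1 hα x).exists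

/-- Two Brauer partitions agree if every pin has a common partner in both. -/
theorem IsBrauer.ext_partner {α β : PartitionMonoid n} (hα : α.IsBrauer) (hβ : β.IsBrauer)
    (h : ∀ x, ∃ y, y ≠ x ∧ α.Same x y ∧ β.Same x y) : α = β := by
  ext x z
  -- Partners in a Brauer partition are unique, so exhibiting connections is enough; nothing has to
  -- be shown unconnected.
  obtain ⟨y, hy, h₁, h₂⟩ := h x
  by_cases hz : z = x
  · subst hz
    exact iff_of_true (.refl _ _) (.refl _ _)
  · constructor <;> intro h'
    · rwa [hα.eq_of_same hz hy h' h₁]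
    · rwa [hβ.eq_of_same hz hy h' h₂]

theorem ofPerm_same_inl_inr (g : Equiv.Perm (Fin n)) (i : Fin n) :
    (ofPerm g).Same (Sum.inl i) (Sum.inr (g i)) := rfl

theorem isBrauer_ofPerm (g : Equiv.Perm (Fin n)) : (ofPerm g).IsBrauer := by
  rw [isBrauer_iff]
  rintro (x | x)
  · refine ⟨Sum.inr (g x), ⟨by simp, rfl⟩, ?_⟩
    rintro (y | y) ⟨hy, h⟩
    · exact (hy (congrArg Sum.inl (g.injective (Eq.symm h)))).elim
    · exact congrArg Sum.inr (Eq.symm h)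
  · refine ⟨Sum.inl (g.symm x), ⟨by simp, (g.apply_symm_apply x).symm⟩, ?_⟩
    rintro (y | y) ⟨hy, h⟩
    · exact congrArg Sum.inl (g.injective ((Eq.symm h).trans (g.apply_symm_apply x).symm))
    · exact (hy (congrArg Sum.inr (Eq.symm h))).elim

theorem ofPerm_one : ofPerm (1 : Equiv.Perm (Fin n)) = 1 := rfl

/-- The order is reversed because diagrams compose from left to right, permutations from right to
left. -/
theorem ofPerm_mul (g h : Equiv.Perm (Fin n)) : ofPerm g * ofPerm h = ofPerm (h * g) := by
  refine ((isBrauer_ofPerm g).mul (isBrauer_ofPerm h)).ext_partner (isBrauer_ofPerm _) ?_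
  have key : ∀ i, (ofPerm g * ofPerm h).Same (Sum.inl i) (Sum.inr (h (g i))) := fun i =>
    mul_same_inl_inr (ofPerm_same_inl_inr g i) (ofPerm_same_inl_inr h (g i))
  rintro (x | x)
  · exact ⟨Sum.inr (h (g x)), by simp, key x, rfl⟩
  · obtain ⟨y, rfl⟩ := h.surjective x
    obtain ⟨y, rfl⟩ := g.surjective y
    exact ⟨Sum.inl y, by simp, (key y).symm, rfl⟩

/-- The atom with blocks `{a, b}`, `{a', b'}` and `{j, j'}` for `j ≠ a, b`. -/
def atomOf (a b : Fin n) : PartitionMonoid n :=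
  ofFibres (ι := Pin n) (Sum.elim
    (fun j => if j = a ∨ j = b then Sum.inl a else Sum.inl j)
    (fun j => if j = a ∨ j = b then Sum.inr a else Sum.inl j))

theorem atom_eq (i : Fin (n - 1)) : atom i = atomOf (idx i) (idxSucc i) := rfl

section Atoms

variable {a b c d : Fin n}

theorem atomOf_inl (a b : Fin n) : (atomOf a b).Same (Sum.inl a) (Sum.inl b) := by
  simp [atomOf]

theorem atomOf_inr (a b : Fin n) : (atomOf a b).Same (Sum.inr a) (Sum.inr b) := by
  simp [atomOf]

theorem atomOf_line {j : Fin n} (ha : j ≠ a) (hb : j ≠ b) :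
    (atomOf a b).Same (Sum.inl j) (Sum.inr j) := by
  simp [atomOf, ha, hb]

theorem atomOf_same_inl_inl_iff {i j : Fin n} :
    (atomOf a b).Same (Sum.inl i) (Sum.inl j) ↔
      i = j ∨ (i = a ∨ i = b) ∧ (j = a ∨ j = b) := by
  simp only [atomOf, ofFibres_same, Sum.elim_inl]
  split_ifs <;> grind

theorem atomOf_same_inr_inr_iff {i j : Fin n} :
    (atomOf a b).Same (Sum.inr i) (Sum.inr j) ↔
      i = j ∨ (i = a ∨ i = b) ∧ (j = a ∨ j = b) := by
  simp only [atomOf, ofFibres_same, Sum.elim_inr]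
  split_ifs <;> grind

theorem atomOf_same_inl_inr_iff {i j : Fin n} :
    (atomOf a b).Same (Sum.inl i) (Sum.inr j) ↔ i = j ∧ i ≠ a ∧ i ≠ b := by
  simp only [atomOf, ofFibres_same, Sum.elim_inl, Sum.elim_inr]
  split_ifs <;> grind

theorem isBrauer_atomOf (h : a ≠ b) : (atomOf a b).IsBrauer := by
  rw [isBrauer_iff]
  have hrl : ∀ i j, (atomOf a b).Same (Sum.inr i) (Sum.inl j) ↔ j = i ∧ j ≠ a ∧ j ≠ b :=
    fun i j => ⟨fun h => atomOf_same_inl_inr_iff.1 h.symm,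
      fun h => (atomOf_same_inl_inr_iff.2 h).symm⟩
  rintro (x | x)
  · by_cases hx : x = a ∨ x = b
    · refine ⟨Sum.inl (if x = a then b else a), ⟨?_, atomOf_same_inl_inl_iff.2 ?_⟩, ?_⟩
      · rw [Ne, Sum.inl.injEq]; grind
      · grind
      · rintro (y | y) ⟨hy, hs⟩
        · rw [Ne, Sum.inl.injEq] at hy
          rw [atomOf_same_inl_inl_iff] at hs
          rw [Sum.inl.injEq]; grind
        · rw [atomOf_same_inl_inr_iff] at hs
          grind
    · refine ⟨Sum.inr x, ⟨Sum.inr_ne_inl, atomOf_same_inl_inr_iff.2 (by grind)⟩, ?_⟩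
      rintro (y | y) ⟨hy, hs⟩
      · rw [Ne, Sum.inl.injEq] at hy
        rw [atomOf_same_inl_inl_iff] at hs
        grind
      · rw [(atomOf_same_inl_inr_iff.1 hs).1]
  · by_cases hx : x = a ∨ x = b
    · refine ⟨Sum.inr (if x = a then b else a), ⟨?_, atomOf_same_inr_inr_iff.2 ?_⟩, ?_⟩
      · rw [Ne, Sum.inr.injEq]; grind
      · grind
      · rintro (y | y) ⟨hy, hs⟩
        · rw [hrl] at hs
          grind
        · rw [Ne, Sum.inr.injEq] at hy
          rw [atomOf_same_inr_inr_iff] at hs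
          rw [Sum.inr.injEq]; grind
    · refine ⟨Sum.inl x, ⟨Sum.inl_ne_inr, (hrl _ _).2 (by grind)⟩, ?_⟩
      rintro (y | y) ⟨hy, hs⟩
      · rw [((hrl _ _).1 hs).1]
      · rw [Ne, Sum.inr.injEq] at hy
        rw [atomOf_same_inr_inr_iff] at hs
        grind

/-- A Brauer partition that contains the blocks of an atom is this atom. -/
theorem IsBrauer.eq_atomOf {α : PartitionMonoid n} (hα : α.IsBrauer) (h : a ≠ b)
    (hl : α.Same (Sum.inl a) (Sum.inl b)) (hr : α.Same (Sum.inr a) (Sum.inr b))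
    (hj : ∀ j, j ≠ a → j ≠ b → α.Same (Sum.inl j) (Sum.inr j)) : α = atomOf a b := by
  refine hα.ext_partner (isBrauer_atomOf h) ?_
  rintro (x | x)
  · by_cases ha : x = a
    · subst ha
      exact ⟨Sum.inl b, by simpa using h.symm, hl, atomOf_inl x b⟩
    · by_cases hb : x = b
      · subst hb
        exact ⟨Sum.inl a, by simpa using h, hl.symm, (atomOf_inl a x).symm⟩
      · exact ⟨Sum.inr x, by simp, hj x ha hb, atomOf_line ha hb⟩
  · by_cases ha : x = a
    · subst ha
      exact ⟨Sum.inr b, by simpa using h.symm, hr, atomOf_inr x b⟩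
    · by_cases hb : x = b
      · subst hb
        exact ⟨Sum.inr a, by simpa using h, hr.symm, (atomOf_inr a x).symm⟩
      · exact ⟨Sum.inl x, by simp, (hj x ha hb).symm, (atomOf_line ha hb).symm⟩

theorem atomOf_comm (h : a ≠ b) : atomOf a b = atomOf b a :=
  (isBrauer_atomOf h).eq_atomOf h.symm (atomOf_inl a b).symm (atomOf_inr a b).symm
    fun _ hb ha => atomOf_line ha hb

theorem atomOf_mul_self (h : a ≠ b) : atomOf a b * atomOf a b = atomOf a b :=
  ((isBrauer_atomOf h).mul (isBrauer_atomOf h)).eq_atomOf h (mul_same_inl_inl (atomOf_inl a b))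
    (mul_same_inr_inr (atomOf_inr a b))
    fun _ ha hb => mul_same_inl_inr (atomOf_line ha hb) (atomOf_line ha hb)

/-- Atoms are permuted under conjugation with permutations. -/
theorem ofPerm_mul_atomOf_mul_ofPerm (g : Equiv.Perm (Fin n)) (h : a ≠ b) :
    ofPerm g * atomOf (g a) (g b) * ofPerm g⁻¹ = atomOf a b := by
  have hg : g a ≠ g b := g.injective.ne h
  have hi : ∀ j, (ofPerm g⁻¹).Same (Sum.inl (g j)) (Sum.inr j) := fun j => by
    simpa using ofPerm_same_inl_inr g⁻¹ (g j)
  have hb := ((isBrauer_ofPerm g).mul (isBrauer_atomOf hg)).mul (isBrauer_ofPerm g⁻¹)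
  refine hb.eq_atomOf h ?_ ?_ ?_
  · exact mul_same_inl_inl (mul_same_inl_inl_of_bracket (ofPerm_same_inl_inr g a)
      (atomOf_inl _ _) (ofPerm_same_inl_inr g b))
  · exact mul_same_inr_inr_of_bracket (hi a) (mul_same_inr_inr (atomOf_inr _ _)) (hi b)
  · intro j ha hb
    exact mul_same_inl_inr (mul_same_inl_inr (ofPerm_same_inl_inr g j)
      (atomOf_line (g.injective.ne ha) (g.injective.ne hb))) (hi j)

theorem ofPerm_mul_atomOf (g : Equiv.Perm (Fin n)) (h : a ≠ b) :
    ofPerm g * atomOf (g a) (g b) = atomOf a b * ofPerm g := by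
  rw [← ofPerm_mul_atomOf_mul_ofPerm g h, mul_assoc _ (ofPerm g⁻¹), ofPerm_mul, mul_inv_cancel,
    ofPerm_one, mul_one]

theorem atomOf_mul_swap (h : a ≠ b) : atomOf a b * ofPerm (Equiv.swap a b) = atomOf a b := by
  refine ((isBrauer_atomOf h).mul (isBrauer_ofPerm _)).eq_atomOf h
    (mul_same_inl_inl (atomOf_inl a b)) ?_ ?_
  · refine mul_same_inr_inr_of_bracket (k := b) (l := a) ?_ (atomOf_inr a b).symm ?_
    · simpa using ofPerm_same_inl_inr (Equiv.swap a b) b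
    · simpa using ofPerm_same_inl_inr (Equiv.swap a b) a
  · intro j ha hb
    refine mul_same_inl_inr (atomOf_line ha hb) ?_
    simpa [Equiv.swap_apply_of_ne_of_ne ha hb] using ofPerm_same_inl_inr (Equiv.swap a b) j

theorem swap_mul_atomOf (h : a ≠ b) : ofPerm (Equiv.swap a b) * atomOf a b = atomOf a b := by
  have := ofPerm_mul_atomOf (Equiv.swap a b) h.symm
  rwa [Equiv.swap_apply_left, Equiv.swap_apply_right, ← atomOf_comm h, atomOf_mul_swap h] at this

theorem swap_mul_atomOf_of_disjoint (hab : a ≠ b) (hac : a ≠ c) (had : a ≠ d) (hbc : b ≠ c)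
    (hbd : b ≠ d) :
    atomOf a b * ofPerm (Equiv.swap c d) = ofPerm (Equiv.swap c d) * atomOf a b := by
  have := ofPerm_mul_atomOf (Equiv.swap c d) hab
  rw [Equiv.swap_apply_of_ne_of_ne hac had, Equiv.swap_apply_of_ne_of_ne hbc hbd] at this
  exact this.symm

theorem atomOf_mul_comm (hab : a ≠ b) (hcd : c ≠ d) (hac : a ≠ c) (had : a ≠ d) (hbc : b ≠ c)
    (hbd : b ≠ d) : atomOf a b * atomOf c d = atomOf c d * atomOf a b := by
  -- These are the two brackets that run through the other atom as lines; the instance with the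
  -- pairs exchanged serves the other product.
  have key : ∀ {a b c d : Fin n}, a ≠ c → a ≠ d → b ≠ c → b ≠ d →
      (atomOf a b * atomOf c d).Same (Sum.inl c) (Sum.inl d) ∧
      (atomOf a b * atomOf c d).Same (Sum.inr a) (Sum.inr b) := fun hac had hbc hbd =>
    ⟨mul_same_inl_inl_of_bracket (atomOf_line hac.symm hbc.symm) (atomOf_inl _ _)
      (atomOf_line had.symm hbd.symm),
    mul_same_inr_inr_of_bracket (atomOf_line hac had) (atomOf_inr _ _) (atomOf_line hbc hbd)⟩
  refine ((isBrauer_atomOf hab).mul (isBrauer_atomOf hcd)).ext_partner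
    ((isBrauer_atomOf hcd).mul (isBrauer_atomOf hab)) ?_
  obtain ⟨h₁, h₂⟩ := key hac had hbc hbd
  obtain ⟨h₃, h₄⟩ := key hac.symm hbc.symm had.symm hbd.symm
  have h₅ := mul_same_inl_inl (β := atomOf c d) (atomOf_inl a b)
  have h₆ := mul_same_inl_inl (β := atomOf a b) (atomOf_inl c d)
  have h₇ := mul_same_inr_inr (α := atomOf c d) (atomOf_inr a b)
  have h₈ := mul_same_inr_inr (α := atomOf a b) (atomOf_inr c d)
  have hline : ∀ j, j ≠ a → j ≠ b → j ≠ c → j ≠ d →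
      (atomOf a b * atomOf c d).Same (Sum.inl j) (Sum.inr j) ∧
      (atomOf c d * atomOf a b).Same (Sum.inl j) (Sum.inr j) := fun j ha hb hc hd =>
    ⟨mul_same_inl_inr (atomOf_line ha hb) (atomOf_line hc hd),
      mul_same_inl_inr (atomOf_line hc hd) (atomOf_line ha hb)⟩
  rintro (x | x) <;> by_cases ha : x = a
  · subst ha; exact ⟨_, by simpa using hab.symm, h₅, h₃⟩
  · by_cases hb : x = b
    · subst hb; exact ⟨_, by simpa using hab, h₅.symm, h₃.symm⟩
    · by_cases hc : x = c
      · subst hc; exact ⟨_, by simpa using hcd.symm, h₁, h₆⟩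
      · by_cases hd : x = d
        · subst hd; exact ⟨_, by simpa using hcd, h₁.symm, h₆.symm⟩
        · exact ⟨Sum.inr x, by simp, hline x ha hb hc hd⟩
  · subst ha; exact ⟨_, by simpa using hab.symm, h₂, h₇⟩
  · by_cases hb : x = b
    · subst hb; exact ⟨_, by simpa using hab, h₂.symm, h₇.symm⟩
    · by_cases hc : x = c
      · subst hc; exact ⟨_, by simpa using hcd.symm, h₈, h₄⟩
      · by_cases hd : x = d
        · subst hd; exact ⟨_, by simpa using hcd, h₈.symm, h₄.symm⟩
        · exact ⟨Sum.inl x, by simp, (hline x ha hb hc hd).1.symm,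
            (hline x ha hb hc hd).2.symm⟩

/-- Both diagrams have the brackets `{a, c}` and `{a', b'}` and the line from `b` to `c'`; on the
left-hand side this line zigzags through the brackets of both atoms. -/
theorem atomOf_mul_atomOf (hab : a ≠ b) (hbc : b ≠ c) (hac : a ≠ c) :
    ofPerm (Equiv.swap a b) * atomOf b c * atomOf a b =
      ofPerm (Equiv.swap b c) * atomOf a b := by
  refine (((isBrauer_ofPerm _).mul (isBrauer_atomOf hbc)).mul
    (isBrauer_atomOf hab)).ext_partner ((isBrauer_ofPerm _).mul (isBrauer_atomOf hab)) ?_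
  have sa := ofPerm_same_inl_inr (Equiv.swap a b) a
  have sb := ofPerm_same_inl_inr (Equiv.swap a b) b
  have sc := ofPerm_same_inl_inr (Equiv.swap a b) c
  have ta := ofPerm_same_inl_inr (Equiv.swap b c) a
  have tb := ofPerm_same_inl_inr (Equiv.swap b c) b
  have tc := ofPerm_same_inl_inr (Equiv.swap b c) c
  simp only [Equiv.swap_apply_left, Equiv.swap_apply_right,
    Equiv.swap_apply_of_ne_of_ne hac.symm hbc.symm, Equiv.swap_apply_of_ne_of_ne hab hac]
    at sa sb sc ta tb tc
  have l₁ : (ofPerm (Equiv.swap a b) * atomOf b c * atomOf a b).Same (Sum.inl a) (Sum.inl c) :=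
    mul_same_inl_inl (mul_same_inl_inl_of_bracket sa (atomOf_inl b c) sc)
  have r₁ : (ofPerm (Equiv.swap b c) * atomOf a b).Same (Sum.inl a) (Sum.inl c) :=
    mul_same_inl_inl_of_bracket ta (atomOf_inl a b) tc
  have l₂ : (ofPerm (Equiv.swap a b) * atomOf b c * atomOf a b).Same (Sum.inl b) (Sum.inr c) :=
    mul_same_inl_inr_of_brackets (mul_same_inl_inr sb (atomOf_line hab hac)) (atomOf_inl a b)
      (mul_same_inr_inr (atomOf_inr b c)) (atomOf_line hac.symm hbc.symm)
  have r₂ : (ofPerm (Equiv.swap b c) * atomOf a b).Same (Sum.inl b) (Sum.inr c) :=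
    mul_same_inl_inr tb (atomOf_line hac.symm hbc.symm)
  have l₃ := mul_same_inr_inr (α := ofPerm (Equiv.swap a b) * atomOf b c) (atomOf_inr a b)
  have r₃ := mul_same_inr_inr (α := ofPerm (Equiv.swap b c)) (atomOf_inr a b)
  have hline : ∀ j, j ≠ a → j ≠ b → j ≠ c →
      (ofPerm (Equiv.swap a b) * atomOf b c * atomOf a b).Same (Sum.inl j) (Sum.inr j) ∧
      (ofPerm (Equiv.swap b c) * atomOf a b).Same (Sum.inl j) (Sum.inr j) := by
    intro j ha hb hc
    have sj := ofPerm_same_inl_inr (Equiv.swap a b) j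
    have tj := ofPerm_same_inl_inr (Equiv.swap b c) j
    rw [Equiv.swap_apply_of_ne_of_ne ha hb] at sj
    rw [Equiv.swap_apply_of_ne_of_ne hb hc] at tj
    exact ⟨mul_same_inl_inr (mul_same_inl_inr sj (atomOf_line hb hc)) (atomOf_line ha hb),
      mul_same_inl_inr tj (atomOf_line ha hb)⟩
  rintro (x | x) <;> by_cases ha : x = a
  · subst ha; exact ⟨_, by simpa using hac.symm, l₁, r₁⟩
  · by_cases hb : x = b
    · subst hb; exact ⟨_, by simp, l₂, r₂⟩
    · by_cases hc : x = c
      · subst hc; exact ⟨_, by simpa using hac, l₁.symm, r₁.symm⟩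
      · exact ⟨Sum.inr x, by simp, hline x ha hb hc⟩
  · subst ha; exact ⟨_, by simpa using hab.symm, l₃, r₃⟩
  · by_cases hb : x = b
    · subst hb; exact ⟨_, by simpa using hab, l₃.symm, r₃.symm⟩
    · by_cases hc : x = c
      · subst hc; exact ⟨_, by simp, l₂.symm, r₂.symm⟩
      · exact ⟨Sum.inl x, by simp, (hline x ha hb hc).1.symm, (hline x ha hb hc).2.symm⟩

end Atoms

/-! ### Relabelling and mirror images. -/

/-- The partition obtained by relabelling the pins. -/
def relabel (α : PartitionMonoid n) (F : Equiv.Perm (Pin n)) : PartitionMonoid n :=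
  Setoid.comap F α

theorem relabel_same (α : PartitionMonoid n) (F : Equiv.Perm (Pin n)) (x y : Pin n) :
    (α.relabel F).Same x y ↔ α.Same (F x) (F y) := Iff.rfl

theorem relabel_injective (F : Equiv.Perm (Pin n)) :
    Function.Injective fun α : PartitionMonoid n => α.relabel F := by
  intro α β h
  ext x y
  have := relabel_same α F (F.symm x) (F.symm y)
  have h' : α.relabel F = β.relabel F := h
  rw [h', relabel_same, Equiv.apply_symm_apply, Equiv.apply_symm_apply] at this
  exact this.symm

theorem IsBrauer.relabel {α : PartitionMonoid n} (hα : α.IsBrauer) (F : Equiv.Perm (Pin n)) :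
    (α.relabel F).IsBrauer := by
  rw [isBrauer_iff] at *
  intro x
  obtain ⟨y, ⟨hy, hs⟩, hu⟩ := hα (F x)
  refine ⟨F.symm y, ⟨fun he => hy ?_, ?_⟩, fun z ⟨hz, hs'⟩ => ?_⟩
  · rw [← he, Equiv.apply_symm_apply]
  · rwa [relabel_same, Equiv.apply_symm_apply]
  · rw [← hu (F z) ⟨F.injective.ne hz, hs'⟩, Equiv.symm_apply_apply]

/-- The mirror image of a partition. -/
def mirror (α : PartitionMonoid n) : PartitionMonoid n := α.relabel (Equiv.sumComm _ _)

theorem mirror_same (α : PartitionMonoid n) (x y : Pin n) :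
    α.mirror.Same x y ↔ α.Same x.swap y.swap := Iff.rfl

theorem mirror_mirror (α : PartitionMonoid n) : α.mirror.mirror = α := by
  ext x y
  rw [mirror_same, mirror_same, Sum.swap_swap, Sum.swap_swap]

theorem mirror_mul (α β : PartitionMonoid n) : (α * β).mirror = β.mirror * α.mirror := by
  have key : ∀ (α β : PartitionMonoid n) x y, (α * β).Same x y →
      (β.mirror * α.mirror).Same x.swap y.swap := by
    intro α β x y h
    -- The map reverses the three columns of pins, which exchanges the two chips.
    have := Conn.lift (Conn β.mirror α.mirror) (conn_equivalence _ _)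
      (Sum.elim (fun i => Sum.inr (Sum.inr i))
        (Sum.elim (fun i => Sum.inr (Sum.inl i)) Sum.inl))
      (fun x y h => by
        have h' : Conn β.mirror α.mirror (snd x.swap) (snd y.swap) :=
          .rel _ _ (Link.right (by rwa [mirror_same, Sum.swap_swap, Sum.swap_swap]))
        rcases x with x | x <;> rcases y with y | y <;> exact h')
      (fun x y h => by
        have h' : Conn β.mirror α.mirror (fst x.swap) (fst y.swap) :=
          .rel _ _ (Link.left (by rwa [mirror_same, Sum.swap_swap, Sum.swap_swap]))
        rcases x with x | x <;> rcases y with y | y <;> exact h') h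
    rcases x with x | x <;> rcases y with y | y <;> exact this
  ext x y
  rw [mirror_same]
  constructor
  · intro h
    simpa using key _ _ _ _ h
  · intro h
    have := key _ _ _ _ h
    rwa [mirror_mirror, mirror_mirror] at this

theorem mirror_atomOf {a b : Fin n} (h : a ≠ b) : (atomOf a b).mirror = atomOf a b :=
  ((isBrauer_atomOf h).relabel _).eq_atomOf h (atomOf_inr a b) (atomOf_inl a b)
    fun _ ha hb => (atomOf_line ha hb).symm

theorem mirror_ofPerm_swap (a b : Fin n) :
    (ofPerm (Equiv.swap a b)).mirror = ofPerm (Equiv.swap a b) := by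
  ext x y
  rw [mirror_same]
  have h : ∀ i j : Fin n, i = Equiv.swap a b j ↔ Equiv.swap a b i = j := fun i j =>
    ⟨fun h => by rw [h, Equiv.swap_apply_self], fun h => by rw [← h, Equiv.swap_apply_self]⟩
  rcases x with x | x <;> rcases y with y | y <;> simp [ofPerm, h]

end PartitionMonoid
namespace PartitionMonoid

variable {n : ℕ}

/-- Only the line at `c` is not immediate: it traverses brackets of all three factors before it
arrives at `c'`. -/
theorem atomOf_mul_atomOf_mul_atomOf {a b c : Fin n} (hab : a ≠ b) (hbc : b ≠ c) (hac : a ≠ c) :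
    atomOf a b * atomOf b c * atomOf a b = atomOf a b := by
  refine (((isBrauer_atomOf hab).mul (isBrauer_atomOf hbc)).mul (isBrauer_atomOf hab)).eq_atomOf
    hab (mul_same_inl_inl (mul_same_inl_inl (atomOf_inl a b)))
    (mul_same_inr_inr (atomOf_inr a b)) ?_
  intro j ha hb
  by_cases hc : j = c
  · subst hc
    exact mul_same_inl_inr_of_brackets
      (mul_same_inl_inr_of_brackets (atomOf_line ha hb) (atomOf_inl b j).symm
        (atomOf_inr a b).symm (atomOf_line hab hac))
      (atomOf_inl a b) (mul_same_inr_inr (atomOf_inr b j)) (atomOf_line ha hb)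
  · exact mul_same_inl_inr (mul_same_inl_inr (atomOf_line ha hb) (atomOf_line hb hc))
      (atomOf_line ha hb)

/-- The mirror image of `atomOf_mul_atomOf`, since transpositions and atoms are their own mirror
images. -/
theorem atomOf_mul_atomOf_mul_swap {a b c : Fin n} (hab : a ≠ b) (hbc : b ≠ c) (hac : a ≠ c) :
    atomOf a b * atomOf b c * ofPerm (Equiv.swap a b) =
      atomOf a b * ofPerm (Equiv.swap b c) := by
  have := congrArg mirror (atomOf_mul_atomOf hab hbc hac)
  simpa only [mirror_mul, mirror_atomOf hab, mirror_atomOf hbc, mirror_ofPerm_swap, mul_assoc]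
    using this

/-! ### Cancelling an atom by bending a line. -/

/-- The permutation of the pins that bends the pin `b'` to the left. -/
def bend (a b : Fin n) : Equiv.Perm (Pin n) :=
  Equiv.swap (Sum.inl a) (Sum.inl b) * Equiv.swap (Sum.inl a) (Sum.inr b)

section Bend

variable {a b : Fin n}

theorem bend_inl_left (a b : Fin n) : bend a b (Sum.inl a) = Sum.inr b := by
  rw [bend, Equiv.Perm.mul_apply, Equiv.swap_apply_left, Equiv.swap_apply_of_ne_of_ne] <;> simp

theorem bend_inl_right (h : a ≠ b) : bend a b (Sum.inl b) = Sum.inl a := by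
  have : (Sum.inl b : Pin n) ≠ Sum.inl a := by simpa using h.symm
  rw [bend, Equiv.Perm.mul_apply, Equiv.swap_apply_of_ne_of_ne this Sum.inl_ne_inr,
    Equiv.swap_apply_right]

theorem bend_inr_right (a b : Fin n) : bend a b (Sum.inr b) = Sum.inl b := by
  rw [bend, Equiv.Perm.mul_apply, Equiv.swap_apply_right, Equiv.swap_apply_left]

theorem bend_inl {j : Fin n} (ha : j ≠ a) (hb : j ≠ b) :
    bend a b (Sum.inl j) = Sum.inl j := by
  have ha' : (Sum.inl j : Pin n) ≠ Sum.inl a := by simpa using ha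
  have hb' : (Sum.inl j : Pin n) ≠ Sum.inl b := by simpa using hb
  rw [bend, Equiv.Perm.mul_apply, Equiv.swap_apply_of_ne_of_ne ha' Sum.inl_ne_inr,
    Equiv.swap_apply_of_ne_of_ne ha' hb']

theorem bend_inr {j : Fin n} (hb : j ≠ b) : bend a b (Sum.inr j) = Sum.inr j := by
  have hb' : (Sum.inr j : Pin n) ≠ Sum.inr b := by simpa using hb
  rw [bend, Equiv.Perm.mul_apply, Equiv.swap_apply_of_ne_of_ne Sum.inr_ne_inl hb',
    Equiv.swap_apply_of_ne_of_ne Sum.inr_ne_inl Sum.inr_ne_inl]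

/-- A partition with the block `{b, b'}` can be recovered from its product with an atom. -/
theorem relabel_atomOf_mul (h : a ≠ b) {α : PartitionMonoid n} (hα : α.IsBrauer)
    (hb : α.Same (Sum.inl b) (Sum.inr b)) : (atomOf a b * α).relabel (bend a b) = α := by
  -- A pin of the second chip, other than `b` and `b'`, has a definite exit in the product. Pin `a`
  -- leaves through the bracket `{a', b'}` of the atom and the line from `b` to `b'`; the others
  -- leave where they stand.
  have key : ∀ x : Pin n, x ≠ Sum.inl b → x ≠ Sum.inr b →
      Conn (atomOf a b) α (snd x) (outer (bend a b x)) := by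
    rintro (x | x) hl hr
    · have hxb : x ≠ b := fun h => hl (congrArg _ h)
      by_cases hxa : x = a
      · subst hxa
        rw [bend_inl_left]
        exact .trans _ _ _ (.rel _ _ (Link.left (atomOf_inr x b))) (.rel _ _ (Link.right hb))
      · rw [bend_inl hxa hxb]
        exact .rel _ _ (Link.left (atomOf_line hxa hxb).symm)
    · rw [bend_inr (fun h => hr (congrArg _ h))]
      exact .refl _
  refine (((isBrauer_atomOf h).mul hα).relabel _).ext_partner hα fun x => ?_
  by_cases hl : x = Sum.inl b
  · subst hl
    refine ⟨Sum.inr b, by simp, ?_, hb⟩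
    rw [relabel_same, bend_inl_right h, bend_inr_right]
    exact mul_same_inl_inl (atomOf_inl a b)
  by_cases hr : x = Sum.inr b
  · subst hr
    refine ⟨Sum.inl b, by simp, ?_, hb.symm⟩
    rw [relabel_same, bend_inl_right h, bend_inr_right]
    exact mul_same_inl_inl (atomOf_inl a b).symm
  obtain ⟨y, hy, hs⟩ := hα.exists_same x
  refine ⟨y, hy, ?_, hs⟩
  -- The partner of `x` also avoids `b` and `b'`, which are partners of each other, so `key` applies
  -- to it.
  have hyl : y ≠ Sum.inl b := by
    rintro rfl
    exact hr (hα.eq_of_same hy.symm (by simp) hs.symm hb)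
  have hyr : y ≠ Sum.inr b := by
    rintro rfl
    exact hl (hα.eq_of_same hy.symm (by simp) hs.symm hb.symm)
  exact Relation.EqvGen.trans _ _ _ (.symm _ _ (key x hl hr))
    (.trans _ _ _ (.rel _ _ (Link.right hs)) (key y hyl hyr))

/-- Every Brauer partition with the block `{a, b}` is a product with an atom. -/
theorem exists_atomOf_mul (h : a ≠ b) {α : PartitionMonoid n} (hα : α.IsBrauer)
    (hb : α.Same (Sum.inl a) (Sum.inl b)) :
    (α.relabel (bend a b)).Same (Sum.inl b) (Sum.inr b) ∧
      atomOf a b * α.relabel (bend a b) = α := by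
  have hs : (α.relabel (bend a b)).Same (Sum.inl b) (Sum.inr b) := by
    rwa [relabel_same, bend_inl_right h, bend_inr_right]
  -- The bent partition has the block `{b, b'}`, so it is also the result of bending its product
  -- with the atom; bending being injective, that product is `α`.
  exact ⟨hs, relabel_injective (bend a b) (relabel_atomOf_mul h (hα.relabel _) hs)⟩

end Bend

end PartitionMonoid

/-! ### The homomorphism from the presented monoid. -/

namespace BrauerPresentation

open PartitionMonoid BrauerSystem

variable {n : ℕ}

/-- The partitions assigned to the generators. -/
def genPartition : Gen n → PartitionMonoid n
  | Gen.sigma i => s i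
  | Gen.theta i => atom i

theorem idx_ne_idxSucc (i : Fin (n - 1)) : idx i ≠ idxSucc i := by
  simp [idx, idxSucc]

/-- Transpositions and atoms are symmetric in their two points, so `j = i + 1` and `j = i - 1`
become one situation: two pairs that share the point `b`. -/
theorem Near.exists_points {i j : Fin (n - 1)} (h : Near i j) : ∃ a b c : Fin n,
    a ≠ b ∧ b ≠ c ∧ a ≠ c ∧ s i = ofPerm (Equiv.swap a b) ∧ atom i = atomOf a b ∧
      s j = ofPerm (Equiv.swap b c) ∧ atom j = atomOf b c := by
  rcases h with h | h
  · have hij : idxSucc i = idx j := Fin.ext h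
    refine ⟨idx i, idx j, idxSucc j, hij ▸ idx_ne_idxSucc i, idx_ne_idxSucc j, ?_, ?_, ?_, rfl,
      rfl⟩
    · simp only [idx, idxSucc, Ne, Fin.mk.injEq]; omega
    · rw [s, hij]
    · rw [atom_eq, hij]
  · have hij : idxSucc j = idx i := Fin.ext h
    refine ⟨idxSucc i, idx i, idx j, (idx_ne_idxSucc i).symm, hij ▸ (idx_ne_idxSucc j).symm, ?_,
      ?_, ?_, ?_, ?_⟩
    · simp only [idx, idxSucc, Ne, Fin.mk.injEq]; omega
    · rw [s, Equiv.swap_comm]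
    · rw [atom_eq, atomOf_comm (idx_ne_idxSucc i)]
    · rw [s, Equiv.swap_comm, hij]
    · rw [atom_eq, atomOf_comm (idx_ne_idxSucc j), hij]

theorem Far.points_ne {i j : Fin (n - 1)} (h : Far i j) :
    idx i ≠ idx j ∧ idx i ≠ idxSucc j ∧ idxSucc i ≠ idx j ∧ idxSucc i ≠ idxSucc j := by
  simp only [idx, idxSucc, Ne, Fin.mk.injEq]
  rcases h with h | h <;> omega

theorem swap_braid {a b c : Fin n} (hab : a ≠ b) (hbc : b ≠ c) (hac : a ≠ c) :
    Equiv.swap a b * Equiv.swap b c * Equiv.swap a b =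
      Equiv.swap b c * Equiv.swap a b * Equiv.swap b c := by
  rw [Equiv.swap_mul_swap_mul_swap hab hac, Equiv.swap_comm a b, Equiv.swap_comm b c,
    Equiv.swap_mul_swap_mul_swap hbc.symm hac.symm, Equiv.swap_comm]

theorem lift_genPartition_eq {a b : FreeMonoid (Gen n)} (h : Rel n a b) :
    FreeMonoid.lift genPartition a = FreeMonoid.lift genPartition b := by
  cases h <;> simp only [σ, θ, map_mul, map_one, FreeMonoid.lift_eval_of, genPartition]
  case sigma_sq i => rw [s, ofPerm_mul, Equiv.swap_mul_self, ofPerm_one]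
  case sigma_comm i j h =>
    obtain ⟨h₁, h₂, h₃, h₄⟩ := h.points_ne
    rw [s, s, ofPerm_mul, ofPerm_mul]
    congr 1
    refine (Equiv.Perm.Disjoint.commute ?_).eq
    intro x
    by_cases hx : x = idx i ∨ x = idxSucc i
    · left
      rcases hx with rfl | rfl
      · exact Equiv.swap_apply_of_ne_of_ne h₁ h₂
      · exact Equiv.swap_apply_of_ne_of_ne h₃ h₄
    · right
      exact Equiv.swap_apply_of_ne_of_ne (fun h => hx (Or.inl h)) (fun h => hx (Or.inr h))
  case sigma_braid i j h =>
    obtain ⟨a, b, c, hab, hbc, hac, h₁, -, h₂, -⟩ := h.exists_points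
    rw [h₁, h₂]
    simp only [ofPerm_mul, ← mul_assoc]
    rw [swap_braid hab hbc hac]
  case theta_sq i => exact atomOf_mul_self (idx_ne_idxSucc i)
  case theta_comm i j h =>
    obtain ⟨h₁, h₂, h₃, h₄⟩ := h.points_ne
    exact atomOf_mul_comm (idx_ne_idxSucc i) (idx_ne_idxSucc j) h₁ h₂ h₃ h₄
  case theta_theta_theta i j h =>
    obtain ⟨a, b, c, hab, hbc, hac, -, h₁, -, h₂⟩ := h.exists_points
    rw [h₁, h₂, atomOf_mul_atomOf_mul_atomOf hab hbc hac]
  case theta_sigma i => exact atomOf_mul_swap (idx_ne_idxSucc i)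
  case sigma_theta i => exact swap_mul_atomOf (idx_ne_idxSucc i)
  case theta_sigma_comm i j h =>
    obtain ⟨h₁, h₂, h₃, h₄⟩ := h.points_ne
    exact swap_mul_atomOf_of_disjoint (idx_ne_idxSucc i) h₁ h₂ h₃ h₄
  case sigma_theta_theta i j h =>
    obtain ⟨a, b, c, hab, hbc, hac, h₁, h₂, h₃, h₄⟩ := h.exists_points
    rw [h₁, h₂, h₃, h₄, atomOf_mul_atomOf hab hbc hac]
  case theta_theta_sigma i j h =>
    obtain ⟨a, b, c, hab, hbc, hac, h₁, h₂, h₃, h₄⟩ := h.exists_points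
    rw [h₁, h₂, h₃, h₄, atomOf_mul_atomOf_mul_swap hab hbc hac]

/-- The homomorphism from the presented monoid to the monoid of partitions. -/
def toPartition (n : ℕ) : T n →* PartitionMonoid n :=
  PresentedMonoid.lift genPartition fun _ _ => lift_genPartition_eq

/-- The generators `σ_i`, indexed by natural numbers. -/
def sigmaSeq (n i : ℕ) : T n :=
  -- The value 1 out of range is harmless, as a `BrauerSystem` with bound `n - 1` speaks only of
  -- smaller indices.
  if h : i < n - 1 then PresentedMonoid.of (Rel n) (Gen.sigma ⟨i, h⟩) else 1

/-- The generators `θ_i`, indexed by natural numbers. -/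
def thetaSeq (n i : ℕ) : T n :=
  if h : i < n - 1 then PresentedMonoid.of (Rel n) (Gen.theta ⟨i, h⟩) else 1

theorem brauerSystem (n : ℕ) : BrauerSystem (n - 1) (sigmaSeq n) (thetaSeq n) where
  sigma_sq i hi := by
    simp only [sigmaSeq, dif_pos hi]
    exact PresentedMonoid.mk_eq_mk_of_rel (Rel.sigma_sq ⟨i, hi⟩)
  sigma_comm i j hi hj h := by
    simp only [sigmaSeq, dif_pos hi, dif_pos hj]
    exact PresentedMonoid.mk_eq_mk_of_rel (Rel.sigma_comm ⟨i, hi⟩ ⟨j, hj⟩ h)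
  sigma_braid i j hi hj h := by
    simp only [sigmaSeq, dif_pos hi, dif_pos hj]
    exact PresentedMonoid.mk_eq_mk_of_rel (Rel.sigma_braid ⟨i, hi⟩ ⟨j, hj⟩ h)
  theta_sq i hi := by
    simp only [thetaSeq, dif_pos hi]
    exact PresentedMonoid.mk_eq_mk_of_rel (Rel.theta_sq ⟨i, hi⟩)
  theta_comm i j hi hj h := by
    simp only [thetaSeq, dif_pos hi, dif_pos hj]
    exact PresentedMonoid.mk_eq_mk_of_rel (Rel.theta_comm ⟨i, hi⟩ ⟨j, hj⟩ h)
  theta_theta_theta i j hi hj h := by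
    simp only [thetaSeq, dif_pos hi, dif_pos hj]
    exact PresentedMonoid.mk_eq_mk_of_rel (Rel.theta_theta_theta ⟨i, hi⟩ ⟨j, hj⟩ h)
  theta_sigma i hi := by
    simp only [sigmaSeq, thetaSeq, dif_pos hi]
    exact PresentedMonoid.mk_eq_mk_of_rel (Rel.theta_sigma ⟨i, hi⟩)
  sigma_theta i hi := by
    simp only [sigmaSeq, thetaSeq, dif_pos hi]
    exact PresentedMonoid.mk_eq_mk_of_rel (Rel.sigma_theta ⟨i, hi⟩)
  theta_sigma_comm i j hi hj h := by
    simp only [sigmaSeq, thetaSeq, dif_pos hi, dif_pos hj]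
    exact PresentedMonoid.mk_eq_mk_of_rel (Rel.theta_sigma_comm ⟨i, hi⟩ ⟨j, hj⟩ h)
  sigma_theta_theta i j hi hj h := by
    simp only [sigmaSeq, thetaSeq, dif_pos hi, dif_pos hj]
    exact PresentedMonoid.mk_eq_mk_of_rel (Rel.sigma_theta_theta ⟨i, hi⟩ ⟨j, hj⟩ h)
  theta_theta_sigma i j hi hj h := by
    simp only [sigmaSeq, thetaSeq, dif_pos hi, dif_pos hj]
    exact PresentedMonoid.mk_eq_mk_of_rel (Rel.theta_theta_sigma ⟨i, hi⟩ ⟨j, hj⟩ h)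

theorem initial_eq_top (n : ℕ) : initial (sigmaSeq n) (thetaSeq n) (n - 1) = ⊤ := by
  rw [eq_top_iff, ← PresentedMonoid.closure_range_of, Submonoid.closure_le]
  rintro _ ⟨⟨i, hi⟩ | ⟨i, hi⟩, rfl⟩
  · have := sigma_mem (sigmaSeq n) (thetaSeq n) hi
    rwa [sigmaSeq, dif_pos hi] at this
  · have := theta_mem (sigmaSeq n) (thetaSeq n) hi
    rwa [thetaSeq, dif_pos hi] at this

theorem toPartition_sigmaSeq {i : ℕ} (h : i + 1 < n) :
    toPartition n (sigmaSeq n i) =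
      ofPerm (Equiv.swap ⟨i, by omega⟩ ⟨i + 1, h⟩) := by
  rw [sigmaSeq, dif_pos (by omega)]
  rfl

theorem toPartition_thetaSeq {i : ℕ} (h : i + 1 < n) :
    toPartition n (thetaSeq n i) = atomOf ⟨i, by omega⟩ ⟨i + 1, h⟩ := by
  rw [thetaSeq, dif_pos (by omega)]
  rfl

theorem isBrauer_toPartition (x : T n) : (toPartition n x).IsBrauer := by
  have hx : x ∈ initial (sigmaSeq n) (thetaSeq n) (n - 1) := initial_eq_top n ▸ trivial
  induction hx using Submonoid.closure_induction with
  | mem x hx =>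
    obtain ⟨i, hi, rfl | rfl⟩ := hx
    · rw [toPartition_sigmaSeq (by omega)]
      exact isBrauer_ofPerm _
    · rw [toPartition_thetaSeq (by omega)]
      exact isBrauer_atomOf (by simp)
  | one => rw [map_one]; exact IsBrauer.one
  | mul x y _ _ hx hy => rw [map_mul]; exact hx.mul hy

/-! ### Normal forms read off from partitions; bijectivity. -/

/-- The elements of `initial (sigmaSeq n) (thetaSeq n) m` move only the first `m + 1` points. -/
theorem toPartition_same_of_lt {m : ℕ} {x : T n}
    (hx : x ∈ initial (sigmaSeq n) (thetaSeq n) m) {j : Fin n} (hj : m < j) :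
    (toPartition n x).Same (Sum.inl j) (Sum.inr j) := by
  induction hx using Submonoid.closure_induction with
  | mem x hx =>
    obtain ⟨i, hi, hx⟩ := hx
    have hne : j ≠ ⟨i, by omega⟩ ∧ j ≠ ⟨i + 1, by omega⟩ := by
      constructor <;> (intro h; simp only [h] at hj; omega)
    rcases hx with rfl | rfl
    · rw [toPartition_sigmaSeq (by omega)]
      have := ofPerm_same_inl_inr
        (Equiv.swap (⟨i, by omega⟩ : Fin n) ⟨i + 1, by omega⟩) j
      rwa [Equiv.swap_apply_of_ne_of_ne hne.1 hne.2] at this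
    · rw [toPartition_thetaSeq (by omega)]
      exact atomOf_line hne.1 hne.2
  | one => rw [map_one]; rfl
  | mul x y _ _ hx hy => rw [map_mul]; exact mul_same_inl_inr hx hy

theorem toPartition_up_same (k r : ℕ) (h : k + r < n) :
    (toPartition n (up (sigmaSeq n) k r)).Same (Sum.inl ⟨k, by omega⟩)
      (Sum.inr ⟨k + r, h⟩) := by
  induction r with
  | zero => rw [up, map_one]; rfl
  | succ r ih =>
    rw [up, map_mul, toPartition_sigmaSeq (by omega)]
    refine mul_same_inl_inr (ih (by omega)) ?_
    have := ofPerm_same_inl_inr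
      (Equiv.swap (⟨k + r, by omega⟩ : Fin n) ⟨k + r + 1, by omega⟩) ⟨k + r, by omega⟩
    rwa [Equiv.swap_apply_left] at this

theorem toPartition_down_same (k r : ℕ) (h : k + r < n) :
    (toPartition n (down (sigmaSeq n) k r)).Same (Sum.inl ⟨k + r, h⟩)
      (Sum.inr ⟨k, by omega⟩) := by
  induction r with
  | zero => rw [down, map_one]; rfl
  | succ r ih =>
    rw [down, map_mul, toPartition_sigmaSeq (by omega)]
    refine mul_same_inl_inr ?_ (ih (by omega))
    have := ofPerm_same_inl_inr
      (Equiv.swap (⟨k + r, by omega⟩ : Fin n) ⟨k + r + 1, by omega⟩) ⟨k + r + 1, by omega⟩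
    rwa [Equiv.swap_apply_right] at this

/-- Together with `toPartition_up_mul_theta_mul_same` this shows that the partner of the left pin `m
+ 1` determines the kind of normal form and the number `k`. -/
theorem toPartition_mul_down_same {m k r : ℕ} (hm : m + 1 < n) (hk : k + r = m + 1) {h : T n}
    (hh : h ∈ initial (sigmaSeq n) (thetaSeq n) m) :
    (toPartition n (h * down (sigmaSeq n) k r)).Same (Sum.inl ⟨m + 1, hm⟩)
      (Sum.inr ⟨k, by omega⟩) := by
  have := toPartition_down_same (n := n) k r (by omega)
  simp only [hk] at this
  rw [map_mul]
  exact mul_same_inl_inr (toPartition_same_of_lt hh (Nat.lt_succ_self m)) this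

theorem toPartition_up_mul_theta_mul_same {m k r : ℕ} (hm : m + 1 < n) (hk : k + r = m)
    (h : T n) :
    (toPartition n (up (sigmaSeq n) k r * thetaSeq n m * h)).Same (Sum.inl ⟨m + 1, hm⟩)
      (Sum.inl ⟨k, by omega⟩) := by
  have := toPartition_up_same (n := n) k r (by omega)
  simp only [hk] at this
  rw [map_mul, map_mul, toPartition_thetaSeq hm]
  exact mul_same_inl_inl (mul_same_inl_inl_of_bracket
    (toPartition_same_of_lt (up_mem _ _ k r hk.le) (Nat.lt_succ_self m))
    (atomOf_inl _ _).symm this)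

/-- Two elements with the same image have normal forms of the same kind with the same `k`, since the
pin `m + 1` has only one partner. The remaining factors `h` and `h'` then have equal images and lie
one level lower. -/
theorem toPartition_injOn {m : ℕ} (hm : m ≤ n - 1) :
    Set.InjOn (toPartition n) (initial (sigmaSeq n) (thetaSeq n) m) := by
  induction m with
  | zero =>
    intro x hx y hy _
    rw [eq_one_of_mem_initial_zero hx, eq_one_of_mem_initial_zero hy]
  | succ m ih =>
    intro x hx y hy hxy
    have S := brauerSystem n
    have hm' : m + 1 < n := by omega
    have hB := isBrauer_toPartition x
    rcases isNormal_of_mem S hm x hx with ⟨k, r, hk, h, hh, rfl⟩ | ⟨k, r, hk, h, hh, rfl⟩ <;>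
      rcases isNormal_of_mem S hm y hy with
        ⟨k', r', hk', h', hh', rfl⟩ | ⟨k', r', hk', h', hh', rfl⟩
    · have h₁ := toPartition_mul_down_same hm' hk hh
      have h₂ := toPartition_mul_down_same hm' hk' hh'
      rw [← hxy] at h₂
      have he := hB.eq_of_same (by simp) (by simp) h₁ h₂
      simp only [Sum.inr.injEq, Fin.mk.injEq] at he
      subst he
      obtain rfl : r = r' := by omega
      -- The ascending product is the inverse of the descending one and cancels it.
      have := congrArg (· * toPartition n (up (sigmaSeq n) k r)) hxy
      simp only [← map_mul, mul_assoc, S.down_mul_up k r (by omega), mul_one] at this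
      rw [ih (by omega) hh hh' this]
    · have h₁ := toPartition_mul_down_same hm' hk hh
      have h₂ := toPartition_up_mul_theta_mul_same hm' hk' h'
      rw [← hxy] at h₂
      have he := hB.eq_of_same (by simp) (by simp; omega) h₁ h₂
      simp at he
    · have h₁ := toPartition_up_mul_theta_mul_same hm' hk h
      have h₂ := toPartition_mul_down_same hm' hk' hh'
      rw [← hxy] at h₂
      have he := hB.eq_of_same (by simp; omega) (by simp) h₁ h₂
      simp at he
    · have h₁ := toPartition_up_mul_theta_mul_same hm' hk h
      have h₂ := toPartition_up_mul_theta_mul_same hm' hk' h'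
      rw [← hxy] at h₂
      have he := hB.eq_of_same (by simp; omega) (by simp; omega) h₁ h₂
      simp only [Sum.inl.injEq, Fin.mk.injEq] at he
      subst he
      obtain rfl : r = r' := by omega
      have := congrArg (toPartition n (down (sigmaSeq n) k r) * ·) hxy
      simp only [← map_mul, ← mul_assoc, S.down_mul_up k r (by omega), one_mul] at this
      simp only [map_mul, toPartition_thetaSeq hm'] at this
      have hne : (⟨m, by omega⟩ : Fin n) ≠ ⟨m + 1, hm'⟩ := by simp
      have hfix : ∀ g ∈ initial (sigmaSeq n) (thetaSeq n) m,
          (toPartition n g).Same (Sum.inl ⟨m + 1, hm'⟩) (Sum.inr ⟨m + 1, hm'⟩) := fun g hg =>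
        toPartition_same_of_lt hg (Nat.lt_succ_self m)
      -- The atom is not invertible, but `h` and `h'` keep the line at `m + 1`, so bending recovers
      -- their images.
      have := congrArg (fun α => α.relabel (bend ⟨m, by omega⟩ ⟨m + 1, hm'⟩)) this
      simp only [relabel_atomOf_mul hne (isBrauer_toPartition _) (hfix h hh),
        relabel_atomOf_mul hne (isBrauer_toPartition _) (hfix h' hh')] at this
      rw [ih (by omega) hh hh' this]

/-- The normal form is built from the partner of the left pin `m + 1`: multiplication by a suitable
permutation, and in the bracket case the removal of an atom, leaves a partition that has the line at
`m + 1` too, to which the induction hypothesis applies. -/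
theorem exists_toPartition_eq {m : ℕ} (hm : m ≤ n - 1) {α : PartitionMonoid n}
    (hα : α.IsBrauer) (hfix : ∀ j : Fin n, m < j → α.Same (Sum.inl j) (Sum.inr j)) :
    ∃ x ∈ initial (sigmaSeq n) (thetaSeq n) m, toPartition n x = α := by
  induction m generalizing α with
  | zero =>
    refine ⟨1, one_mem _, ?_⟩
    rw [map_one]
    -- All points except 0 carry lines already, so only `0'` is left as the partner of 0.
    have hall : ∀ j : Fin n, α.Same (Sum.inl j) (Sum.inr j) := by
      intro j
      rcases Nat.eq_zero_or_pos j with hj | hj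
      · obtain ⟨y, hy, hs⟩ := hα.exists_same (Sum.inl j)
        have hval : ∀ i : Fin n, i ≠ j → 0 < (i : ℕ) := fun i hi =>
          Nat.pos_of_ne_zero fun h => hi (Fin.ext (h.trans hj.symm))
        rcases y with i | i
        · have hi : i ≠ j := fun h => hy (congrArg _ h)
          have := hα.eq_of_same (by simpa using hi.symm) (by simp) hs.symm (hfix i (hval i hi))
          simp at this
        · by_cases hi : i = j
          · rwa [hi] at hs
          · have := hα.eq_of_same (by simp) (by simp) hs.symm (hfix i (hval i hi)).symm
            exact (hi (Sum.inl_injective this).symm).elim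
      · exact hfix j hj
    refine IsBrauer.one.ext_partner hα ?_
    rintro (x | x)
    · exact ⟨Sum.inr x, by simp, rfl, hall x⟩
    · exact ⟨Sum.inl x, by simp, rfl, (hall x).symm⟩
  | succ m ih =>
    have S := brauerSystem n
    have hm' : m + 1 < n := by omega
    have hle := initial_mono (sigmaSeq n) (thetaSeq n) (Nat.le_succ m)
    obtain ⟨y, hy, hs⟩ := hα.exists_same (Sum.inl ⟨m + 1, hm'⟩)
    -- Pins beyond `m + 1` are already matched among themselves.
    have hyle : ∀ k : Fin n, y = Sum.inl k ∨ y = Sum.inr k → (k : ℕ) ≤ m + 1 := by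
      intro k hk
      by_contra! hlt
      have hkm : k ≠ ⟨m + 1, hm'⟩ := by rintro rfl; simp at hlt
      rcases hk with rfl | rfl
      · have := hα.eq_of_same (by simpa using hkm.symm) (by simp) hs.symm (hfix k hlt)
        simp at this
      · have := hα.eq_of_same (by simp) (by simp) hs.symm (hfix k hlt).symm
        exact hkm (Sum.inl_injective this).symm
    rcases y with ⟨k, hkn⟩ | ⟨k, hkn⟩
    · have hk1 : k ≤ m + 1 := hyle _ (Or.inl rfl)
      have hk2 : k ≠ m + 1 := by rintro rfl; exact hy rfl
      obtain ⟨r, rfl⟩ : ∃ r, m = k + r := ⟨m - k, by omega⟩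
      have hd := down_mem (sigmaSeq n) (thetaSeq n) k r le_rfl
      have hBd := (isBrauer_toPartition (down (sigmaSeq n) k r)).mul hα
      have hfd : ∀ j : Fin n, k + r < j →
          (toPartition n (down (sigmaSeq n) k r)).Same (Sum.inl j) (Sum.inr j) := fun j hj =>
        toPartition_same_of_lt hd hj
      -- The descending factor moves the bracket `{k, m + 1}` to the neighbours `{m, m + 1}` (here
      -- `m = k + r`), where an atom can be split off.
      have hb : (toPartition n (down (sigmaSeq n) k r) * α).Same (Sum.inl ⟨k + r, by omega⟩)
          (Sum.inl ⟨k + r + 1, hm'⟩) :=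
        mul_same_inl_inl_of_bracket (toPartition_down_same k r (by omega)) hs.symm
          (hfd _ (Nat.lt_succ_self _))
      have hne : (⟨k + r, by omega⟩ : Fin n) ≠ ⟨k + r + 1, hm'⟩ := by simp
      obtain ⟨h₁, h₂⟩ := exists_atomOf_mul hne hBd hb
      obtain ⟨x, hx, he⟩ := ih (by omega) (hBd.relabel (bend ⟨k + r, by omega⟩ ⟨k + r + 1, hm'⟩))
        (fun j hj => by
          by_cases hj' : j = ⟨k + r + 1, hm'⟩
          · rw [hj']; exact h₁
          · have hj'' : j ≠ ⟨k + r, by omega⟩ := by intro h; simp [h] at hj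
            have hlt : k + r + 1 < j := by
              have : (j : ℕ) ≠ k + r + 1 := fun h => hj' (Fin.ext h)
              omega
            rw [relabel_same, bend_inl hj'' hj', bend_inr hj']
            exact mul_same_inl_inr (hfd j hj) (hfix j hlt))
      refine ⟨up (sigmaSeq n) k r * thetaSeq n (k + r) * x,
        mul_mem (mul_mem (up_mem _ _ k r (by omega)) (theta_mem _ _ (by omega))) (hle hx), ?_⟩
      rw [map_mul, map_mul, he, toPartition_thetaSeq hm', mul_assoc, h₂, ← mul_assoc, ← map_mul,
        S.up_mul_down k r (by omega), map_one, one_mul]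
    · have hk1 : k ≤ m + 1 := hyle _ (Or.inr rfl)
      obtain ⟨r, hr⟩ : ∃ r, k + r = m + 1 := ⟨m + 1 - k, by omega⟩
      have hu := toPartition_up_same (n := n) k r (by omega)
      simp only [hr] at hu
      -- The ascending factor moves the end `k'` of the line to `(m + 1)'`.
      obtain ⟨x, hx, he⟩ := ih (by omega)
        (hα.mul (isBrauer_toPartition (up (sigmaSeq n) k r))) (fun j hj => by
          by_cases hj' : j = ⟨m + 1, hm'⟩
          · rw [hj']; exact mul_same_inl_inr hs hu
          · have hlt : m + 1 < j := by
              have : (j : ℕ) ≠ m + 1 := fun h => hj' (Fin.ext h)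
              omega
            exact mul_same_inl_inr (hfix j hlt)
              (toPartition_same_of_lt (up_mem _ _ k r hr.le) hlt))
      refine ⟨x * down (sigmaSeq n) k r, mul_mem (hle hx) (down_mem _ _ k r hr.le), ?_⟩
      rw [map_mul, he, mul_assoc, ← map_mul, S.up_mul_down k r (by omega), map_one, mul_one]

theorem toPartition_injective (n : ℕ) : Function.Injective (toPartition n) := by
  have := toPartition_injOn (n := n) le_rfl
  rw [initial_eq_top] at this
  exact fun x y h => this trivial trivial h

/-- The homomorphism from the presented monoid to the Brauer monoid. -/
def toBrauer (n : ℕ) : T n →* BrauerMonoid n :=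
  (toPartition n).codRestrict (BrauerMonoid n) isBrauer_toPartition

theorem toBrauer_bijective (n : ℕ) : Function.Bijective (toBrauer n) := by
  constructor
  · intro x y h
    exact toPartition_injective n (congrArg Subtype.val h)
  · rintro ⟨α, hα⟩
    -- At level `n - 1` no point lies beyond the range, so the condition on fixed lines is vacuous.
    obtain ⟨x, -, hx⟩ := exists_toPartition_eq (n := n) le_rfl hα fun j hj => by omega
    exact ⟨x, Subtype.ext hx⟩

end BrauerPresentation

theorem theorem1 (n : ℕ) :
    ∃ φ : BrauerPresentation.T n ≃* BrauerMonoid n,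
      (∀ i : Fin (n - 1),
        (φ (PresentedMonoid.of (BrauerPresentation.Rel n) (BrauerPresentation.Gen.sigma i)) :
          PartitionMonoid n) = PartitionMonoid.s i) ∧
      (∀ i : Fin (n - 1),
        (φ (PresentedMonoid.of (BrauerPresentation.Rel n) (BrauerPresentation.Gen.theta i)) :
          PartitionMonoid n) = PartitionMonoid.atom i) :=
  ⟨MulEquiv.ofBijective (BrauerPresentation.toBrauer n)
    (BrauerPresentation.toBrauer_bijective n), fun _ => rfl, fun _ => rfl⟩
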